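/- Let $\mathcal A$ be the two-dimensional complex cyclic $A_\infty$-algebra spanned by $a$ (degree $1$) and $b$ (degree $2$), with differential $da=b$, symmetric pairing $\langle a,b\rangle=1$, and vanishing multiplication and higher operations. Let $V=\Sigma\mathcal A$ be its suspension with the induced odd symplectic form $\langle b,a\rangle=1=-\langle a,b\rangle$. Its dual $V^*$ has basis $x=a^*$ (degree $0$) and $\xi=-b^*$ (degree $-1$), with inverse form $\langle x,\xi\rangle^{-1}=\langle \xi,x\rangle^{-1}=1$ (and $0$ on the pairs $(x,x)$, $(\xi,\xi)$) and dual differential $d\xi=-x$, $dx=0$. Let $$\mathfrak h=\bigoplus_{k\ge 0}\big[(V^*)^{\otimes k}\big]_{\mathbb Z/k}$$ be the graded space of cyclic words in $x,\xi$; the empty cyclic word is denoted $\nu$. The noncommutative BV complex (at $\hbar=1$) is the graded symmetric algebra $S(\mathfrak h)=\mathbb C[\nu]\otimes S(\mathfrak h_+)$, where $\mathfrak h_+$ is spanned by the nonempty cyclic words, with differential $D=d+\delta+\nabla$. Here $d$ is the derivation induced by the dual differential; $\nabla$ is the derivation extending the cobracket $$\nabla(a_1\cdots a_n)=\sum_{i<j}\pm\langle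 a_i,a_j\rangle^{-1}(a_{i+1}\cdots a_{j-1})(a_{j+1}\cdots a_na_1\cdots a_{i-1});$$ and $\delta(w_1\cdots w_n)=\sum_{i<j}\pm\{w_i,w_j\}\,w_1\cdots\widehat{w_i}\cdots\widehat{w_j}\cdots w_n$ is the Chevalley–Eilenberg differential of the bracket $$\{(a_1\cdots a_m),(b_1\cdots b_n)\}=\sum_{i,j}\pm\langle a_i,b_j\rangle^{-1}(a_{i+1}\cdots a_ma_1\cdots a_{i-1}b_{j+1}\cdots b_nb_1\cdots b_{j-1}),$$ all signs being given by the Koszul rule. Let $i_1,\dots,i_k\ge 0$ be integers. The element $(x^{i_1})(x^{i_2})\cdots(x^{i_k})\in S(\mathfrak h)$ is a cocycle, and there is a unique polynomial $p_{i_1,\dots,i_k}(\nu)\in\mathbb C[\nu]\subset S(\mathfrak h)$ that is cohomologous to it. For every positive integer $N$, $$p_{i_1,\dots,i_k}(N)=\frac{\int_{\mathcal H_N}\operatorname{Tr}(X^{i_1})\cdots\operatorname{Tr}(X^{i_k})\,e^{-\frac12\operatorname{Tr}(X^2)}\,dX}{\int_{\mathcal H_N}e^{-\frac12\operatorname{Tr}(X^2)}\,dX},$$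 where $\mathcal H_N$ is the real vector space of Hermitian $N\times N$ matrices and $dX$ is Lebesgue measure transported to $\mathcal H_N$ along any linear identification with $\mathbb R^{N^2}$. Both integrals converge absolutely, and the denominator is nonzero. -/

import Mathlib

open Polynomial

namespace NCBV

/-! ### The cyclic algebra `𝒜` with `d a = b`, `⟨a, b⟩ = 1` and zero multiplication -/

/-- The two generators of `𝒜`. -/
inductive Gen
  | a
  | b

/-- Cohomological degrees in `𝒜`: `|a| = 1`, `|b| = 2`. -/
def Gen.deg : Gen → ℕ
  | .a => 1
  | .b => 2

/-- The symmetric pairing of `𝒜`, of odd degree. -/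
def pairing : Gen → Gen → ℂ
  | .a, .b => 1
  | .b, .a => 1
  | _, _ => 0

/-- Matrix of the differential of `𝒜`: `dGen u v` is the coefficient of `v` in `d u`. -/
def dGen : Gen → Gen → ℂ
  | .a, .b => 1
  | _, _ => 0

/-- The odd symplectic form on the suspension `Σ𝒜`: `⟨Σu, Σv⟩ = (-1)^{|u|} ⟨u, v⟩`,
so that `⟨b, a⟩ = 1 = -⟨a, b⟩`. -/
def symp (u v : Gen) : ℂ := (-1) ^ u.deg * pairing u v

/-! ### The dual space `V* = (Σ𝒜)*`, with basis `x = a*`, `ξ = -b*` -/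

inductive Letter
  | x
  | xi

/-- `x` and `ξ` as linear functionals on `Σ𝒜`, by their values on the basis `a`, `b`. -/
def Letter.coord : Letter → Gen → ℂ
  | .x, .a => 1
  | .xi, .b => -1
  | _, _ => 0

/-- Minus the cohomological degree: `x` has degree `0` and `ξ` has degree `-1`. -/
def Letter.wt : Letter → ℕ
  | .x => 0
  | .xi => 1

/-- The inverse form on `V*`: `⟨x, ξ⟩⁻¹ = 1 = ⟨ξ, x⟩⁻¹`. See `form_spec`. -/
def form : Letter → Letter → ℂ
  | .x, .xi => 1
  | .xi, .x => 1
  | _, _ => 0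

/-- The differential on `V*` dual to that of `𝒜`: `d* ξ = -x`, `d* x = 0`. See `dLetter_spec`. -/
noncomputable def dLetter : Letter → (Letter →₀ ℂ)
  | .x => 0
  | .xi => Finsupp.single Letter.x (-1)

/-- The dual basis `a* = x`, `b* = -ξ` of `V*`. -/
noncomputable def dualBasis : Gen → (Letter →₀ ℂ)
  | .a => Finsupp.single Letter.x 1
  | .b => Finsupp.single Letter.xi (-1)

/-- Bilinear extension of `form`. -/
noncomputable def formExt (f g : Letter →₀ ℂ) : ℂ :=
  f.sum fun l c => g.sum fun m e => c * e * form l m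

/-- `D_l u = ⟨u, -⟩ ∈ V*`. -/
noncomputable def Dl (u : Gen) : Letter →₀ ℂ :=
  symp u .a • dualBasis .a + symp u .b • dualBasis .b

/-- `D_r u = ⟨-, u⟩ ∈ V*`. -/
noncomputable def Dr (u : Gen) : Letter →₀ ℂ :=
  symp .a u • dualBasis .a + symp .b u • dualBasis .b

theorem formExt_single (l m : Letter) (c e : ℂ) :
    formExt (Finsupp.single l c) (Finsupp.single m e) = c * e * form l m := by
  simp [formExt]

/-- `form` is the inverse of the symplectic form: `⟨-,-⟩⁻¹ ∘ (D_l ⊗ D_r) = ⟨-,-⟩`, with the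
Koszul sign `(D_l ⊗ D_r)(u ⊗ v) = (-1)^{|D_r| |u|} D_l u ⊗ D_r v`, where `|u| = deg u - 1`
in `Σ𝒜` and `D_r` is odd. -/
theorem form_spec (u v : Gen) :
    (-1 : ℂ) ^ (u.deg - 1) * formExt (Dl u) (Dr v) = symp u v := by
  have h1 : Dl .a = Finsupp.single .xi 1 := by simp [Dl, symp, pairing, Gen.deg, dualBasis]
  have h2 : Dl .b = Finsupp.single .x 1 := by simp [Dl, symp, pairing, Gen.deg, dualBasis]
  have h3 : Dr .a = Finsupp.single .xi (-1) := by simp [Dr, symp, pairing, Gen.deg, dualBasis]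
  have h4 : Dr .b = Finsupp.single .x (-1) := by simp [Dr, symp, pairing, Gen.deg, dualBasis]
  cases u <;> cases v <;> simp only [h1, h2, h3, h4, formExt_single] <;>
    simp [symp, pairing, Gen.deg, form]

/-- `dLetter` is dual to the differential of `𝒜`: `(d* f)(u) = f (d u)`. -/
theorem dLetter_spec (l : Letter) (u : Gen) :
    (dLetter l).sum (fun m c => c * m.coord u) =
      dGen u .a * l.coord .a + dGen u .b * l.coord .b := by
  cases l <;> cases u <;> simp [dLetter, dGen, Letter.coord, -Finsupp.single_neg]

/-! ### Words and multi-words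

A word `l₁ ⋯ l_k` is a basis element of `(V*)^{⊗ k}`; a list of words `[w₁, …, w_n]` is a basis
element `w₁ ⊗ ⋯ ⊗ w_n` of the tensor algebra on `⨁_k (V*)^{⊗ k}`. -/

abbrev Word := List Letter

abbrev MultiWord := List Word

/-- Minus the degree of a word. -/
def wwt (w : Word) : ℕ := (w.map Letter.wt).sum

/-- Minus the degree of a multi-word. -/
def mwt (A : MultiWord) : ℕ := (A.map wwt).sum

/-- The Koszul sign for exchanging elements of degrees `-m` and `-n`. -/
def koszul (m n : ℕ) : ℂ := (-1) ^ (m * n)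

/-- The tensor algebra on `⨁_k (V*)^{⊗ k}`, as a vector space. -/
abbrev Pre := MultiWord →₀ ℂ

/-- The relation `(l w) = (-1)^{|l||w|} (w l)`, inside a product of words: the generator of the
cyclic group acts trivially. -/
noncomputable def rotRel (A : MultiWord) (l : Letter) (w : Word) (B : MultiWord) : Pre :=
  Finsupp.single (A ++ (l :: w) :: B) 1 -
    koszul l.wt (wwt w) • Finsupp.single (A ++ (w ++ [l]) :: B) 1

/-- The relation `u v = (-1)^{|u||v|} v u` between words `u`, `v`, inside a product of words:
the symmetric group acts trivially. -/
noncomputable def swapRel (A : MultiWord) (u v : Word) (B : MultiWord) : Pre :=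
  Finsupp.single (A ++ u :: v :: B) 1 -
    koszul (wwt u) (wwt v) • Finsupp.single (A ++ v :: u :: B) 1

/-- The subspace spanned by the relations. -/
noncomputable def relations : Submodule ℂ Pre :=
  Submodule.span ℂ
    ({r | ∃ A l w B, r = rotRel A l w B} ∪ {r | ∃ A u v B, r = swapRel A u v B})

/-- The graded symmetric algebra `S(𝔥)` of the space of cyclic words
`𝔥 = ⨁_{k ≥ 0} [(V*)^{⊗ k}]_{ℤ/k}`, `V = Σ𝒜`. The empty cyclic word is `ν`. -/
abbrev SymCyc := Pre ⧸ relations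

/-! ### The differential `d + δ + ∇` -/

/-- All ways to write a word as `s l t` with a letter `l`. -/
def splits : Word → List (Word × Letter × Word)
  | [] => []
  | l :: w => ([], l, w) :: (splits w).map fun q => (l :: q.1, q.2.1, q.2.2)

/-- The derivation `d*` on words, `s l t ↦ Σ (-1)^{|s|} s (d* l) t`. -/
noncomputable def dWord (w : Word) : Word →₀ ℂ :=
  ((splits w).map fun q =>
    koszul 1 (wwt q.1) • (dLetter q.2.1).mapDomain fun m => q.1 ++ m :: q.2.2).sum

/-- One term of the cobracket, for `w = s l r` with `r = v m t`: after a cyclic rotation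
`s l v m t ↦ l v m t s` and moving `m` past `v`, contract `l` with `m`; this gives
`± ⟨l, m⟩⁻¹ (v)(t s)`. -/
noncomputable def cobracketTerm (s : Word) (l : Letter) (v : Word) (m : Letter) (t : Word) : Pre :=
  Finsupp.single [v, t ++ s]
    (form l m * koszul (wwt s) (l.wt + wwt v + m.wt + wwt t) * koszul m.wt (wwt v))

/-- The cobracket `∇(a₁ ⋯ a_n) = Σ_{i<j} ± ⟨a_i, a_j⟩⁻¹ (a_{i+1} ⋯ a_{j-1})(a_{j+1} ⋯ a_n a₁ ⋯ a_{i-1})`. -/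
noncomputable def cobracket (w : Word) : Pre :=
  ((splits w).map fun q =>
    ((splits q.2.2).map fun p => cobracketTerm q.1 q.2.1 p.1 p.2.1 p.2.2).sum).sum

/-- One term of the bracket, for `u = s l t` and `v = s' m t'`: after the cyclic rotations
`s l t ↦ l t s` and `s' m t' ↦ m t' s'` and moving `m` past `t s`, contract `l` with `m`. -/
noncomputable def bracketTerm (s : Word) (l : Letter) (t : Word) (s' : Word) (m : Letter)
    (t' : Word) : Word →₀ ℂ :=
  Finsupp.single (t ++ s ++ t' ++ s')
    (form l m * koszul (wwt s) (l.wt + wwt t) * koszul (wwt s') (m.wt + wwt t') *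
      koszul m.wt (wwt t + wwt s))

/-- The bracket of cyclic words: `{(a₁ ⋯ a_m), (b₁ ⋯ b_n)} =
Σ_{i,j} ± ⟨a_i, b_j⟩⁻¹ (a_{i+1} ⋯ a_m a₁ ⋯ a_{i-1} b_{j+1} ⋯ b_n b₁ ⋯ b_{j-1})`. -/
noncomputable def bracket (u v : Word) : Word →₀ ℂ :=
  ((splits u).map fun q =>
    ((splits v).map fun p => bracketTerm q.1 q.2.1 q.2.2 p.1 p.2.1 p.2.2).sum).sum

/-- `{u, -}` extended to products of words as a derivation of degree `|u| + 1`. -/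
noncomputable def bracketWith (u : Word) : MultiWord → Pre
  | [] => 0
  | v :: B =>
    (bracket u v).mapDomain (fun w => w :: B) +
      koszul (wwt u + 1) (wwt v) • (bracketWith u B).mapDomain (fun A => v :: A)

/-- `d + ∇` on a single word. -/
noncomputable def dOne (w : Word) : Pre :=
  (dWord w).mapDomain (fun u => [u]) + cobracket w

/-- The differential `d + δ + ∇` on a product of words. Here `d` and `∇` act as derivations and
`δ(w₁ ⋯ w_n) = Σ_{i<j} ± {w_i, w_j} w₁ ⋯ ŵ_i ⋯ ŵ_j ⋯ w_n`; equivalently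
`D(w B) = (d w + ∇ w) B + {w, B} + (-1)^{|w|} w D(B)`. -/
noncomputable def dMulti : MultiWord → Pre
  | [] => 0
  | w :: B =>
    (dOne w).mapDomain (fun A => A ++ B) + bracketWith w B +
      koszul 1 (wwt w) • (dMulti B).mapDomain (fun A => w :: A)

/-- Linear extension of `dMulti`. -/
noncomputable def dPre : Pre →ₗ[ℂ] Pre := Finsupp.linearCombination ℂ dMulti

/-! ### The differential descends to `SymCyc` -/

theorem koszul_congr {a b c d : ℕ} (h : Even (a * b) ↔ Even (c * d)) :
    koszul a b = koszul c d := neg_one_pow_congr h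

/-- The class of a multi-word. -/
noncomputable def cls (A : MultiWord) : SymCyc := relations.mkQ (Finsupp.single A 1)

theorem mkQ_single (A : MultiWord) (c : ℂ) :
    relations.mkQ (Finsupp.single A c) = c • cls A := by
  rw [cls, ← map_smul, Finsupp.smul_single, smul_eq_mul, mul_one]

theorem cls_rot (A : MultiWord) (l : Letter) (w : Word) (B : MultiWord) :
    cls (A ++ (l :: w) :: B) = koszul l.wt (wwt w) • cls (A ++ (w ++ [l]) :: B) := by
  rw [cls, cls, ← map_smul, ← sub_eq_zero, ← map_sub]
  exact (Submodule.Quotient.mk_eq_zero _).2 (Submodule.subset_span (Or.inl ⟨A, l, w, B, rfl⟩))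

theorem cls_swap (A : MultiWord) (u v : Word) (B : MultiWord) :
    cls (A ++ u :: v :: B) = koszul (wwt u) (wwt v) • cls (A ++ v :: u :: B) := by
  rw [cls, cls, ← map_smul, ← sub_eq_zero, ← map_sub]
  exact (Submodule.Quotient.mk_eq_zero _).2 (Submodule.subset_span (Or.inr ⟨A, u, v, B, rfl⟩))

/-- A linear map killing all relations, given by values on multi-words. -/
theorem relations_le_ker {E : Type*} [AddCommGroup E] [Module ℂ E] (f : Pre →ₗ[ℂ] E)
    (h₁ : ∀ A l w B, f (Finsupp.single (A ++ (l :: w) :: B) 1) =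
      koszul l.wt (wwt w) • f (Finsupp.single (A ++ (w ++ [l]) :: B) 1))
    (h₂ : ∀ A u v B, f (Finsupp.single (A ++ u :: v :: B) 1) =
      koszul (wwt u) (wwt v) • f (Finsupp.single (A ++ v :: u :: B) 1)) :
    relations ≤ LinearMap.ker f := by
  refine Submodule.span_le.2 ?_
  rintro r (⟨A, l, w, B, rfl⟩ | ⟨A, u, v, B, rfl⟩)
  · simp only [SetLike.mem_coe, LinearMap.mem_ker, rotRel, map_sub, map_smul, h₁, sub_self]
  · simp only [SetLike.mem_coe, LinearMap.mem_ker, swapRel, map_sub, map_smul]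
    rw [h₂, sub_self]

/-- Left multiplication by a word on `SymCyc`. -/
noncomputable def consQ (w : Word) : SymCyc →ₗ[ℂ] SymCyc :=
  relations.liftQ (relations.mkQ ∘ₗ Finsupp.lmapDomain ℂ ℂ (fun A => w :: A))
    (relations_le_ker _
      (fun A l u B => by
        simpa [Finsupp.mapDomain_single, cls] using cls_rot (w :: A) l u B)
      (fun A u v B => by
        simpa [Finsupp.mapDomain_single, cls] using cls_swap (w :: A) u v B))

theorem consQ_mkQ (w : Word) (X : Pre) :
    consQ w (relations.mkQ X) = relations.mkQ (X.mapDomain fun A => w :: A) := rfl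

theorem consQ_cls (w : Word) (A : MultiWord) : consQ w (cls A) = cls (w :: A) := by
  rw [cls, consQ_mkQ, Finsupp.mapDomain_single, cls]

theorem mkQ_mapDomain {α : Type*} (f : α → MultiWord) (X : α →₀ ℂ) :
    relations.mkQ (X.mapDomain f) = X.sum fun a c => c • cls (f a) := by
  rw [Finsupp.mapDomain, Finsupp.sum, map_sum, Finsupp.sum]
  exact Finset.sum_congr rfl fun a _ => mkQ_single _ _

/-- Comparison of two linear functions on homogeneous elements. -/
theorem mapDomain_congr {α : Type*} (S : Set α) (f g : α → MultiWord) (c : ℂ) (X : α →₀ ℂ)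
    (hX : X ∈ Finsupp.supported ℂ ℂ S) (h : ∀ a ∈ S, cls (f a) = c • cls (g a)) :
    relations.mkQ (X.mapDomain f) = c • relations.mkQ (X.mapDomain g) := by
  rw [mkQ_mapDomain, mkQ_mapDomain, Finsupp.smul_sum]
  refine Finset.sum_congr rfl fun a ha => ?_
  simp only
  rw [h a (hX ha), smul_comm]

theorem wwt_append (u v : Word) : wwt (u ++ v) = wwt u + wwt v := by simp [wwt]

theorem wwt_cons (l : Letter) (v : Word) : wwt (l :: v) = l.wt + wwt v := by simp [wwt]

theorem wwt_nil : wwt [] = 0 := rfl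

theorem mwt_cons (u : Word) (B : MultiWord) : mwt (u :: B) = wwt u + mwt B := by simp [mwt]

theorem wwt_of_mem_splits {w : Word} {q : Word × Letter × Word} (h : q ∈ splits w) :
    wwt w = wwt q.1 + q.2.1.wt + wwt q.2.2 := by
  induction w generalizing q with
  | nil => simp [splits] at h
  | cons l w ih =>
    simp only [splits, List.mem_cons, List.mem_map] at h
    rcases h with rfl | ⟨p, hp, rfl⟩
    · simp [wwt_cons, wwt_nil]
    · simp only [wwt_cons, ih hp]; ring

theorem splits_append_singleton (w : Word) (l : Letter) :
    splits (w ++ [l]) =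
      (splits w).map (fun q => (q.1, q.2.1, q.2.2 ++ [l])) ++ [(w, l, [])] := by
  induction w with
  | nil => simp [splits]
  | cons k w ih => simp [splits, ih, Function.comp_def]

theorem form_parity {l m : Letter} (h : form l m ≠ 0) : l.wt + m.wt = 1 := by
  cases l <;> cases m <;> simp [form, Letter.wt] at h ⊢

theorem form_symm (l m : Letter) : form l m = form m l := by
  cases l <;> cases m <;> rfl

theorem koszul_mul (a b c d : ℕ) : koszul a b * koszul c d = (-1) ^ (a * b + c * d) := by
  simp [koszul, pow_add]

theorem bracketTerm_mem (s : Word) (l : Letter) (t s' : Word) (m : Letter) (t' : Word) (n : ℕ)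
    (h : Even (wwt s + l.wt + wwt t + (wwt s' + m.wt + wwt t') + 1 + n)) :
    bracketTerm s l t s' m t' ∈ Finsupp.supported ℂ ℂ {w : Word | Even (wwt w + n)} := by
  by_cases hf : form l m = 0
  · simp [bracketTerm, hf]
  · refine Finsupp.single_mem_supported _ _ ?_
    have := form_parity hf
    simp only [Set.mem_ofPred_eq, wwt_append]
    have e : wwt s + l.wt + wwt t + (wwt s' + m.wt + wwt t') + 1 + n =
      (wwt t + wwt s + wwt t' + wwt s' + n) + 2 := by omega
    rw [e] at h
    simpa [Nat.even_add] using h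

theorem bracket_mem (u v : Word) :
    bracket u v ∈ Finsupp.supported ℂ ℂ {w : Word | Even (wwt w + (wwt u + wwt v + 1))} := by
  refine list_sum_mem ?_
  intro x hx
  obtain ⟨q, hq, rfl⟩ := List.mem_map.1 hx
  refine list_sum_mem ?_
  intro x hx
  obtain ⟨p, hp, rfl⟩ := List.mem_map.1 hx
  refine bracketTerm_mem _ _ _ _ _ _ _ ?_
  rw [← wwt_of_mem_splits hq, ← wwt_of_mem_splits hp]
  exact ⟨wwt u + wwt v + 1, by ring⟩

theorem dOne_mem (w : Word) :
    dOne w ∈ Finsupp.supported ℂ ℂ {A : MultiWord | Even (mwt A + (wwt w + 1))} := by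
  refine Submodule.add_mem _ ?_ ?_
  · rw [← Finsupp.lmapDomain_apply ℂ ℂ, dWord, map_list_sum, List.map_map]
    refine list_sum_mem ?_
    intro x hx
    obtain ⟨⟨s, l, t⟩, hq, rfl⟩ := List.mem_map.1 hx
    have hw := wwt_of_mem_splits hq
    simp only [Function.comp, map_smul]
    refine Submodule.smul_mem _ _ ?_
    cases l
    · simp [dLetter]
    · simp only [dLetter, Finsupp.mapDomain_single, Finsupp.lmapDomain_apply]
      refine Finsupp.single_mem_supported _ _ ?_
      simp only [Set.mem_ofPred_eq, mwt, List.map_cons, List.map_nil, List.sum_cons, List.sum_nil,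
        hw, wwt_append, wwt_cons, Letter.wt]
      exact ⟨wwt s + wwt t + 1, by ring⟩
  · refine list_sum_mem ?_
    intro x hx
    obtain ⟨q, hq, rfl⟩ := List.mem_map.1 hx
    refine list_sum_mem ?_
    intro x hx
    obtain ⟨p, hp, rfl⟩ := List.mem_map.1 hx
    have hw := wwt_of_mem_splits hq
    have hw' := wwt_of_mem_splits hp
    by_cases hf : form q.2.1 p.2.1 = 0
    · simp [cobracketTerm, hf]
    · refine Finsupp.single_mem_supported _ _ ?_
      have := form_parity hf
      simp only [Set.mem_ofPred_eq, mwt, List.map_cons, List.map_nil, List.sum_cons, List.sum_nil,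
        wwt_append]
      exact ⟨wwt p.1 + wwt p.2.2 + wwt q.1 + 1, by omega⟩

theorem cls_move (A : MultiWord) (v : Word) (B : MultiWord) :
    cls (A ++ v :: B) = koszul (mwt A) (wwt v) • cls (v :: (A ++ B)) := by
  induction A with
  | nil => simp [mwt, koszul]
  | cons a A ih =>
    rw [List.cons_append, ← consQ_cls, ih, map_smul, consQ_cls]
    have := cls_swap [] a v (A ++ B)
    simp only [List.nil_append] at this
    rw [this, smul_smul, mwt_cons, koszul_mul, koszul]
    congr 2
    ring

theorem cls_rotate (p q : Word) (B : MultiWord) :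
    cls ((p ++ q) :: B) = koszul (wwt p) (wwt q) • cls ((q ++ p) :: B) := by
  induction p generalizing q with
  | nil => simp [wwt_nil, koszul]
  | cons l p ih =>
    have := cls_rot [] l (p ++ q) B
    simp only [List.nil_append] at this
    rw [List.cons_append, this, List.append_assoc, ih, smul_smul, List.append_assoc,
      List.singleton_append, koszul_mul, koszul]
    congr 1
    refine neg_one_pow_congr ?_
    simp only [wwt_append, wwt_cons, wwt_nil, Nat.even_add, Nat.even_mul]
    tauto

theorem sgn_congr {m n : ℕ} (h : (m : ZMod 2) = n) : (-1 : ℂ) ^ m = (-1) ^ n :=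
  neg_one_pow_congr (by
    rw [← ZMod.natCast_eq_zero_iff_even, ← ZMod.natCast_eq_zero_iff_even, h])

theorem koszul_eq (m n : ℕ) : koszul m n = if Even m ∨ Even n then 1 else -1 := by
  rw [koszul, neg_one_pow_eq_ite]
  simp only [Nat.even_mul]

theorem single_eq_smul_single {α : Type*} {a a' : α} {c d e : ℂ} (h : a = a') (h' : d = c * e) :
    Finsupp.single a d = c • Finsupp.single a' e := by
  rw [h, h', Finsupp.smul_single, smul_eq_mul]

theorem list_sum_map_smul {α E : Type*} [AddCommGroup E] [Module ℂ E] (L : List α) (c : ℂ)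
    (f g : α → E) (h : ∀ a ∈ L, f a = c • g a) : (L.map f).sum = c • (L.map g).sum := by
  rw [List.smul_sum, List.map_map]
  exact congrArg List.sum (List.map_congr_left h)

theorem list_sum_comm {α β E : Type*} [AddCommMonoid E] (L : List α) (M : List β)
    (f : α → β → E) :
    (L.map fun a => (M.map fun b => f a b).sum).sum =
      (M.map fun b => (L.map fun a => f a b).sum).sum := by
  induction L with
  | nil => simp
  | cons a L ih => simp [ih, List.sum_map_add]

/-- Sums over the splittings of `l w` and of `w l`. -/
theorem sum_splits_rot {E : Type*} [AddCommGroup E] [Module ℂ E] (w : Word) (l : Letter) (c : ℂ)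
    (f g : Word × Letter × Word → E) (h₀ : f ([], l, w) = c • g (w, l, []))
    (h : ∀ q ∈ splits w, f (l :: q.1, q.2.1, q.2.2) = c • g (q.1, q.2.1, q.2.2 ++ [l])) :
    ((splits (l :: w)).map f).sum = c • ((splits (w ++ [l])).map g).sum := by
  rw [splits_append_singleton, splits, List.map_cons, List.sum_cons, List.map_append,
    List.sum_append, List.map_map, List.map_map, List.map_singleton, List.sum_singleton,
    smul_add, h₀, add_comm]
  congr 1
  exact list_sum_map_smul _ _ _ _ h

theorem bracket_rot_right (u w : Word) (l : Letter) :
    bracket u (l :: w) = koszul l.wt (wwt w) • bracket u (w ++ [l]) := by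
  refine list_sum_map_smul _ _ _ _ fun q _ => ?_
  refine sum_splits_rot _ _ _ _ _ ?_ fun p hp => ?_
  · refine single_eq_smul_single (by simp) ?_
    simp only [wwt_nil, koszul, mul_assoc, ← pow_add, mul_left_comm _ (form _ _)]
    congr 1
    refine sgn_congr ?_
    push_cast
    generalize (wwt w : ZMod 2) = w0, (l.wt : ZMod 2) = l0, (wwt q.1 : ZMod 2) = s0, (q.2.1.wt : ZMod 2) = k0, (wwt q.2.2 : ZMod 2) = t0
    revert w0 l0 s0 k0 t0
    decide
  · refine single_eq_smul_single (by simp) ?_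
    simp only [wwt_of_mem_splits hp, wwt_append, wwt_cons, wwt_nil, koszul, mul_assoc, ← pow_add,
      mul_left_comm _ (form _ _)]
    congr 1
    refine sgn_congr ?_
    push_cast
    generalize (l.wt : ZMod 2) = l0, (wwt q.1 : ZMod 2) = s0, (q.2.1.wt : ZMod 2) = k0, (wwt q.2.2 : ZMod 2) = t0, (wwt p.1 : ZMod 2) = s1, (p.2.1.wt : ZMod 2) = k1, (wwt p.2.2 : ZMod 2) = t1
    revert l0 s0 k0 t0 s1 k1 t1
    decide

theorem bracket_rot_left (u w : Word) (l : Letter) :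
    bracket (l :: w) u = koszul l.wt (wwt w) • bracket (w ++ [l]) u := by
  refine sum_splits_rot _ _ _ _ _ ?_ fun q hq => ?_
  · refine list_sum_map_smul _ _ _ _ fun p _ => ?_
    refine single_eq_smul_single (by simp) ?_
    simp only [wwt_nil, koszul, mul_assoc, ← pow_add, mul_left_comm _ (form _ _)]
    congr 1
    refine sgn_congr ?_
    push_cast
    generalize (wwt w : ZMod 2) = w0, (l.wt : ZMod 2) = l0, (wwt p.1 : ZMod 2) = s0, (p.2.1.wt : ZMod 2) = k0, (wwt p.2.2 : ZMod 2) = t0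
    revert w0 l0 s0 k0 t0
    decide
  · refine list_sum_map_smul _ _ _ _ fun p _ => ?_
    refine single_eq_smul_single (by simp) ?_
    simp only [wwt_of_mem_splits hq, wwt_append, wwt_cons, wwt_nil, koszul, mul_assoc, ← pow_add,
      mul_left_comm _ (form _ _)]
    congr 1
    refine sgn_congr ?_
    push_cast
    generalize (l.wt : ZMod 2) = l0, (wwt q.1 : ZMod 2) = s0, (q.2.1.wt : ZMod 2) = k0, (wwt q.2.2 : ZMod 2) = t0, (wwt p.1 : ZMod 2) = s1, (p.2.1.wt : ZMod 2) = k1, (wwt p.2.2 : ZMod 2) = t1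
    revert l0 s0 k0 t0 s1 k1 t1
    decide

theorem form_cast {l m : Letter} (h : form l m ≠ 0) : (l.wt : ZMod 2) = 1 + m.wt := by
  cases l <;> cases m <;> simp [form, Letter.wt] at h ⊢
  rfl

theorem bracket_symm (u v : Word) (B : MultiWord) :
    relations.mkQ ((bracket u v).mapDomain fun w => w :: B) =
      koszul (wwt u) (wwt v) • relations.mkQ ((bracket v u).mapDomain fun w => w :: B) := by
  simp only [← Finsupp.lmapDomain_apply ℂ ℂ, bracket, map_list_sum, List.map_map,
    Function.comp_def]
  rw [list_sum_comm]
  refine list_sum_map_smul _ _ _ _ fun p hp => ?_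
  refine list_sum_map_smul _ _ _ _ fun q hq => ?_
  simp only [Finsupp.lmapDomain_apply, bracketTerm, Finsupp.mapDomain_single, mkQ_single]
  by_cases hf : form q.2.1 p.2.1 = 0
  · simp [hf, form_symm p.2.1]
  have hf' := form_cast hf
  rw [List.append_assoc (q.2.2 ++ q.1), cls_rotate, smul_smul, smul_smul,
    ← List.append_assoc (p.2.2 ++ p.1), form_symm p.2.1]
  congr 1
  simp only [wwt_of_mem_splits hp, wwt_of_mem_splits hq, wwt_append, koszul, mul_assoc,
    ← pow_add, mul_left_comm _ (form _ _)]
  congr 1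
  refine sgn_congr ?_
  push_cast
  rw [hf']
  generalize (wwt q.1 : ZMod 2) = s0, (wwt q.2.2 : ZMod 2) = t0, (wwt p.1 : ZMod 2) = s1,
    (p.2.1.wt : ZMod 2) = k1, (wwt p.2.2 : ZMod 2) = t1
  revert s0 t0 s1 k1 t1
  decide

theorem dWord_rot (w : Word) (l : Letter) (B : MultiWord) :
    relations.mkQ ((dWord (l :: w)).mapDomain fun u => u :: B) =
      koszul l.wt (wwt w) • relations.mkQ ((dWord (w ++ [l])).mapDomain fun u => u :: B) := by
  simp only [← Finsupp.lmapDomain_apply ℂ ℂ, dWord, map_list_sum, List.map_map,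
    Function.comp_def]
  refine sum_splits_rot _ _ _ _ _ ?_ fun q hq => ?_
  · cases l
    · simp [dLetter]
    · have := cls_rot [] Letter.x w B
      simp only [List.nil_append] at this
      simp only [dLetter, Finsupp.lmapDomain_apply, Finsupp.mapDomain_single, map_smul,
        mkQ_single, List.nil_append, this, smul_smul]
      congr 1
      simp only [koszul_eq, Letter.wt, wwt_nil]
      by_cases h : Even (wwt w) <;> simp [h]
  · obtain ⟨s, k, t⟩ := q
    have hw := wwt_of_mem_splits hq
    cases k
    · simp [dLetter]
    · have := cls_rot [] l (s ++ Letter.x :: t) B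
      simp only [List.nil_append, List.append_assoc, List.cons_append] at this
      simp only [dLetter, Finsupp.lmapDomain_apply, Finsupp.mapDomain_single, map_smul,
        mkQ_single, List.cons_append, this, smul_smul]
      congr 1
      simp only [koszul_eq, Letter.wt, hw, wwt_cons, wwt_append, Nat.even_add]
      by_cases h : Even (wwt s) <;> by_cases h' : Even (wwt t) <;> cases l <;>
        simp [h, h']

theorem cobracket_rot (w : Word) (l : Letter) (B : MultiWord) :
    relations.mkQ ((cobracket (l :: w)).mapDomain fun A => A ++ B) =
      koszul l.wt (wwt w) •
        relations.mkQ ((cobracket (w ++ [l])).mapDomain fun A => A ++ B) := by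
  simp only [← Finsupp.lmapDomain_apply ℂ ℂ, cobracket, map_list_sum, List.map_map,
    Function.comp_def]
  set F : Pre → SymCyc := fun X =>
    relations.mkQ ((Finsupp.lmapDomain ℂ ℂ fun A : MultiWord => A ++ B) X) with hF
  change ((splits (l :: w)).map fun q => ((splits q.2.2).map fun p =>
      F (cobracketTerm q.1 q.2.1 p.1 p.2.1 p.2.2)).sum).sum =
    _ • ((splits (w ++ [l])).map fun q => ((splits q.2.2).map fun p =>
      F (cobracketTerm q.1 q.2.1 p.1 p.2.1 p.2.2)).sum).sum
  rw [splits_append_singleton, splits]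
  simp only [List.map_cons, List.sum_cons, List.map_append, List.sum_append, List.map_map,
    Function.comp_def, splits_append_singleton, List.map_nil, List.sum_nil, add_zero, splits,
    List.sum_map_add, smul_add]
  rw [add_comm]
  congr 1
  · refine list_sum_map_smul _ _ _ _ fun q hq => ?_
    refine list_sum_map_smul _ _ _ _ fun p hp => ?_
    have hw := wwt_of_mem_splits hq
    have hw' := wwt_of_mem_splits hp
    simp only [hF, cobracketTerm, Finsupp.lmapDomain_apply, Finsupp.mapDomain_single, mkQ_single,
      smul_smul, List.append_assoc, List.singleton_append]
    congr 1
    simp only [hw, hw', wwt_append, wwt_cons, wwt_nil, koszul, mul_assoc, ← pow_add,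
      mul_left_comm _ (form _ _)]
    congr 1
    refine sgn_congr ?_
    push_cast
    generalize (l.wt : ZMod 2) = l0, (wwt q.1 : ZMod 2) = s0, (q.2.1.wt : ZMod 2) = k0, (wwt p.1 : ZMod 2) = s1, (p.2.1.wt : ZMod 2) = k1, (wwt p.2.2 : ZMod 2) = t1
    revert l0 s0 k0 s1 k1 t1
    decide
  · refine list_sum_map_smul _ _ _ _ fun p hp => ?_
    have hw := wwt_of_mem_splits hp
    simp only [hF, cobracketTerm, Finsupp.lmapDomain_apply, Finsupp.mapDomain_single, mkQ_single,
      smul_smul, List.append_nil, List.nil_append, List.cons_append]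
    by_cases hf : form l p.2.1 = 0
    · simp [hf, form_symm p.2.1]
    have hf' := form_cast hf
    have := cls_swap [] p.1 p.2.2 B
    simp only [List.nil_append] at this
    rw [this, smul_smul, form_symm p.2.1]
    congr 1
    simp only [hw, wwt_nil, koszul, mul_assoc, ← pow_add, mul_left_comm _ (form _ _)]
    congr 1
    refine sgn_congr ?_
    push_cast
    rw [hf']
    generalize (wwt p.1 : ZMod 2) = s1, (p.2.1.wt : ZMod 2) = k1, (wwt p.2.2 : ZMod 2) = t1
    revert s1 k1 t1
    decide

theorem dOne_rot (w : Word) (l : Letter) (B : MultiWord) :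
    relations.mkQ ((dOne (l :: w)).mapDomain fun A => A ++ B) =
      koszul l.wt (wwt w) • relations.mkQ ((dOne (w ++ [l])).mapDomain fun A => A ++ B) := by
  simp only [dOne, Finsupp.mapDomain_add, map_add, smul_add, cobracket_rot,
    ← Finsupp.mapDomain_comp, Function.comp_def]
  congr 1
  exact dWord_rot w l B

theorem mkQ_bracketWith_cons (u v : Word) (B : MultiWord) :
    relations.mkQ (bracketWith u (v :: B)) =
      relations.mkQ ((bracket u v).mapDomain fun w => w :: B) +
        koszul (wwt u + 1) (wwt v) • consQ v (relations.mkQ (bracketWith u B)) := by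
  rw [bracketWith, map_add, map_smul, consQ_mkQ]

theorem mkQ_dMulti_cons (w : Word) (B : MultiWord) :
    relations.mkQ (dMulti (w :: B)) =
      relations.mkQ ((dOne w).mapDomain fun A => A ++ B) + relations.mkQ (bracketWith w B) +
        koszul 1 (wwt w) • consQ w (relations.mkQ (dMulti B)) := by
  rw [dMulti, map_add, map_add, map_smul, consQ_mkQ]

theorem consQ_rot (l : Letter) (w : Word) (X : SymCyc) :
    consQ (l :: w) X = koszul l.wt (wwt w) • consQ (w ++ [l]) X := by
  obtain ⟨X, rfl⟩ := relations.mkQ_surjective X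
  rw [consQ_mkQ, consQ_mkQ]
  exact mapDomain_congr Set.univ _ _ _ _ (by simp) fun A _ => cls_rot [] l w A

theorem consQ_swap (u v : Word) (X : SymCyc) :
    consQ u (consQ v X) = koszul (wwt u) (wwt v) • consQ v (consQ u X) := by
  obtain ⟨X, rfl⟩ := relations.mkQ_surjective X
  simp only [consQ_mkQ, ← Finsupp.mapDomain_comp]
  exact mapDomain_congr Set.univ _ _ _ _ (by simp) fun A _ => cls_swap [] u v A

/-- If two multi-words are proportional in `SymCyc`, so are their products with `bracket u v`. -/
theorem bracket_congr (u v : Word) (X Y : MultiWord) (c : ℂ) (h : cls X = c • cls Y) :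
    relations.mkQ ((bracket u v).mapDomain fun w => w :: X) =
      c • relations.mkQ ((bracket u v).mapDomain fun w => w :: Y) := by
  refine mapDomain_congr Set.univ _ _ _ _ (by simp) fun w _ => ?_
  rw [← consQ_cls, h, map_smul, consQ_cls]

theorem cls_append_left (A X Y : MultiWord) (c : ℂ) (h : cls X = c • cls Y) :
    cls (A ++ X) = c • cls (A ++ Y) := by
  induction A with
  | nil => exact h
  | cons a A ih => rw [List.cons_append, List.cons_append, ← consQ_cls, ih, map_smul, consQ_cls]

theorem dOne_congr (w : Word) (X Y : MultiWord) (c : ℂ) (h : cls X = c • cls Y) :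
    relations.mkQ ((dOne w).mapDomain fun A => A ++ X) =
      c • relations.mkQ ((dOne w).mapDomain fun A => A ++ Y) :=
  mapDomain_congr Set.univ _ _ _ _ (by simp) fun A _ => cls_append_left A X Y c h

theorem bracketWith_append (u : Word) (A X Y : MultiWord) (c : ℂ) (hc : cls X = c • cls Y)
    (h : relations.mkQ (bracketWith u X) = c • relations.mkQ (bracketWith u Y)) :
    relations.mkQ (bracketWith u (A ++ X)) = c • relations.mkQ (bracketWith u (A ++ Y)) := by
  induction A with
  | nil => exact h
  | cons a A ih =>
    rw [List.cons_append, List.cons_append, mkQ_bracketWith_cons, mkQ_bracketWith_cons, ih,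
      bracket_congr u a _ _ c (cls_append_left A X Y c hc), map_smul, smul_add, smul_comm c]

theorem dMulti_append (A X Y : MultiWord) (c : ℂ) (hc : cls X = c • cls Y)
    (hb : ∀ u, relations.mkQ (bracketWith u X) = c • relations.mkQ (bracketWith u Y))
    (h : relations.mkQ (dMulti X) = c • relations.mkQ (dMulti Y)) :
    relations.mkQ (dMulti (A ++ X)) = c • relations.mkQ (dMulti (A ++ Y)) := by
  induction A with
  | nil => exact h
  | cons a A ih =>
    rw [List.cons_append, List.cons_append, mkQ_dMulti_cons, mkQ_dMulti_cons, ih,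
      dOne_congr a _ _ c (cls_append_left A X Y c hc), bracketWith_append a A X Y c hc (hb a),
      map_smul, smul_add, smul_add, smul_comm c]

theorem bracketWith_rot (u : Word) (l : Letter) (w : Word) (B : MultiWord) :
    relations.mkQ (bracketWith u ((l :: w) :: B)) =
      koszul l.wt (wwt w) • relations.mkQ (bracketWith u ((w ++ [l]) :: B)) := by
  rw [mkQ_bracketWith_cons, mkQ_bracketWith_cons, bracket_rot_right, consQ_rot, smul_add,
    Finsupp.mapDomain_smul, map_smul, smul_comm (koszul l.wt (wwt w))]
  congr 3
  simp [wwt_append, wwt_cons, wwt_nil, add_comm]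

theorem bracketWith_rot_left (l : Letter) (w : Word) (B : MultiWord) :
    bracketWith (l :: w) B = koszul l.wt (wwt w) • bracketWith (w ++ [l]) B := by
  induction B with
  | nil => simp [bracketWith]
  | cons v B ih =>
    rw [bracketWith, bracketWith, ih, bracket_rot_left, smul_add, Finsupp.mapDomain_smul,
      Finsupp.mapDomain_smul, smul_comm (koszul l.wt (wwt w))]
    congr 3
    simp [wwt_append, wwt_cons, wwt_nil, add_comm]

theorem bracket_move (u v w : Word) (B : MultiWord) :
    relations.mkQ ((bracket u v).mapDomain fun a => a :: w :: B) =
      koszul (wwt u + wwt v + 1) (wwt w) •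
        consQ w (relations.mkQ ((bracket u v).mapDomain fun a => a :: B)) := by
  rw [consQ_mkQ, ← Finsupp.mapDomain_comp]
  refine mapDomain_congr _ _ _ _ _ (bracket_mem u v) fun a ha => ?_
  have := cls_swap [] a w B
  simp only [List.nil_append] at this
  rw [this]
  congr 1
  refine koszul_congr ?_
  simp only [Set.mem_ofPred_eq, Nat.even_add, Nat.even_mul] at ha ⊢
  tauto

theorem dOne_move (u w : Word) (B : MultiWord) :
    relations.mkQ ((dOne u).mapDomain fun A => A ++ w :: B) =
      koszul (wwt u + 1) (wwt w) •
        consQ w (relations.mkQ ((dOne u).mapDomain fun A => A ++ B)) := by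
  rw [consQ_mkQ, ← Finsupp.mapDomain_comp]
  refine mapDomain_congr _ _ _ _ _ (dOne_mem u) fun A hA => ?_
  rw [cls_move]
  congr 1
  refine koszul_congr ?_
  simp only [Set.mem_ofPred_eq, Nat.even_add, Nat.even_mul] at hA ⊢
  tauto

theorem bracketWith_swap (u v w : Word) (B : MultiWord) :
    relations.mkQ (bracketWith u (v :: w :: B)) =
      koszul (wwt v) (wwt w) • relations.mkQ (bracketWith u (w :: v :: B)) := by
  simp only [mkQ_bracketWith_cons, bracket_move u v w, bracket_move u w v, map_add, map_smul,
    smul_add, consQ_swap v w, smul_smul]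
  by_cases hu : Even (wwt u) <;> by_cases hv : Even (wwt v) <;> by_cases hw : Even (wwt w) <;>
    simp [koszul_eq, Nat.even_add, hu, hv, hw] <;> abel

theorem dMulti_rot (l : Letter) (w : Word) (B : MultiWord) :
    relations.mkQ (dMulti ((l :: w) :: B)) =
      koszul l.wt (wwt w) • relations.mkQ (dMulti ((w ++ [l]) :: B)) := by
  rw [mkQ_dMulti_cons, mkQ_dMulti_cons, dOne_rot, bracketWith_rot_left, consQ_rot, map_smul,
    smul_add, smul_add, smul_comm (koszul l.wt (wwt w)) (koszul 1 _)]
  congr 3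
  simp [wwt_append, wwt_cons, wwt_nil, add_comm]

theorem dMulti_swap (u v : Word) (B : MultiWord) :
    relations.mkQ (dMulti (u :: v :: B)) =
      koszul (wwt u) (wwt v) • relations.mkQ (dMulti (v :: u :: B)) := by
  simp only [mkQ_dMulti_cons, mkQ_bracketWith_cons, dOne_move u v, dOne_move v u, map_add,
    map_smul, smul_add, consQ_swap u v, bracket_symm u v, smul_smul]
  by_cases hu : Even (wwt u) <;> by_cases hv : Even (wwt v) <;>
    simp [koszul_eq, Nat.even_add, hu, hv] <;> abel

/-- `dPre` composed with the projection to `SymCyc` kills the relations. -/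
theorem relations_le_ker_dPre : relations ≤ LinearMap.ker (relations.mkQ ∘ₗ dPre) := by
  refine relations_le_ker _ (fun A l w B => ?_) (fun A u v B => ?_)
  · simp only [LinearMap.comp_apply, dPre, Finsupp.linearCombination_single, one_smul]
    exact dMulti_append A _ _ _ (cls_rot [] l w B) (fun u => bracketWith_rot u l w B)
      (dMulti_rot l w B)
  · simp only [LinearMap.comp_apply, dPre, Finsupp.linearCombination_single, one_smul]
    exact dMulti_append A _ _ _ (cls_swap [] u v B) (fun w => bracketWith_swap w u v B)
      (dMulti_swap u v B)

/-- The differential `d + δ + ∇` on `S(𝔥)`. -/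
noncomputable def differential : SymCyc →ₗ[ℂ] SymCyc :=
  relations.liftQ (relations.mkQ ∘ₗ dPre) relations_le_ker_dPre

theorem differential_cls (A : MultiWord) : differential (cls A) = relations.mkQ (dMulti A) := by
  change relations.mkQ (dPre (Finsupp.single A 1)) = _
  rw [dPre, Finsupp.linearCombination_single, one_smul]

/-- Two elements of the complex are cohomologous if they differ by a coboundary. -/
def Cohomologous (z w : SymCyc) : Prop := ∃ η : SymCyc, differential η = z - w

/-- The inclusion `ℂ[ν] → S(𝔥)`, sending `ν^m` to the product of `m` empty cyclic words. -/
noncomputable def ofNuPoly (p : ℂ[X]) : SymCyc := p.sum fun m c => c • cls (List.replicate m [])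

/-- Polynomials in `ν` are cocycles. -/
theorem differential_ofNuPoly (p : ℂ[X]) : differential (ofNuPoly p) = 0 := by
  have hb : ∀ m, bracketWith [] (List.replicate m []) = 0 := fun m => by
    induction m with
    | zero => rfl
    | succ m ih => simp [List.replicate_succ, bracketWith, ih, bracket, splits]
  have hd : ∀ m, dMulti (List.replicate m []) = 0 := fun m => by
    induction m with
    | zero => rfl
    | succ m ih =>
      simp [List.replicate_succ, dMulti, ih, hb, dOne, dWord, cobracket, splits]
  simp [ofNuPoly, Polynomial.sum, differential_cls, hd]

/-- The element `(x^{i₁})(x^{i₂}) ⋯ (x^{i_k})`. -/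
noncomputable def multiTraceCochain (i : List ℕ) : SymCyc :=
  cls (i.map fun n => List.replicate n Letter.x)

/-! ### Gaussian integrals over Hermitian matrices -/

/-- The real vector space of Hermitian `N × N` matrices. -/
abbrev Herm (N : ℕ) := selfAdjoint (Matrix (Fin N) (Fin N) ℂ)

/-- Linear identifications of the space of Hermitian matrices with some `ℝⁿ` exist. -/
theorem exists_coordinates (N : ℕ) : ∃ n : ℕ, Nonempty ((Fin n → ℝ) ≃ₗ[ℝ] Herm N) := by
  have : Module.Finite ℝ (Herm N) :=
    inferInstanceAs (Module.Finite ℝ (selfAdjoint.submodule ℝ (Matrix (Fin N) (Fin N) ℂ)))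
  exact ⟨_, ⟨(Module.finBasis ℝ (Herm N)).equivFun.symm⟩⟩

/-- `Tr(X^{i₁}) ⋯ Tr(X^{i_k})`. -/
noncomputable def multiTrace (i : List ℕ) {N : ℕ} (X : Matrix (Fin N) (Fin N) ℂ) : ℂ :=
  (i.map fun n => (X ^ n).trace).prod

/-- `exp(-½ Tr(X²))`. -/
noncomputable def gaussWeight {N : ℕ} (X : Matrix (Fin N) (Fin N) ℂ) : ℂ :=
  Complex.exp (-(1 / 2) * (X ^ 2).trace)

end NCBV

/-! The differential is the Schwinger–Dyson (loop) equation of the Gaussian matrix model, written in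
cyclic words.

Every term of `D` uses up one `ξ`, so products of words in `x` alone are cocycles. In the next
degree every product of words can be rotated and reordered into `(ξ x^n) B` with `B` a product of
words `(x^m)`. For these, `differential_xi` gives `Σ_{a+b=n-1} (x^a)(x^b) B + Σ m (x^{n+m-1})
B/(x^m) - (x^{n+1}) B`, the second sum running over the factors of `B`. Read as a recursion, this
trades a nonempty word `(x^{n+1})` for products of smaller total length. Induction on total length
ends at powers of `ν`, which gives existence (`multiTraceCochain_mem`).

For the integral formula, `evalAt X` sets `ξ = 0` and sends `(x^n)` to `Tr(X^n)`, hence `ν` to `N`.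
By `sum_schwingerDyson`, the value of the coboundary above at `X`, multiplied by the Gaussian
weight, is the sum over `k, l` of the derivatives of `(X^n)_{kl} Tr(X^{i₁}) ⋯ e^{-Tr(X²)/2}` in the
directions of the elementary matrices `E_{kl}`, extended complex-linearly from Hermitian directions.
Integration by parts makes its integral vanish. So the Gaussian integral kills all coboundaries
(`integral_evalAt_differential`), while on a polynomial in `ν` it is the value at `N` times the
normalisation.

Uniqueness needs no computation of cohomology: the integral formula fixes the values of the
polynomial at all natural numbers. -/

namespace NCBV

/-! ### The differential on words without `ξ` or with a single `ξ` -/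

/-- The word `x^n`. -/
def xWord (n : ℕ) : Word := List.replicate n Letter.x

/-- The product of words `x^{i₁} ⋯ x^{i_k}`. -/
def xWords (i : List ℕ) : MultiWord := i.map xWord

theorem multiTraceCochain_eq (i : List ℕ) : multiTraceCochain i = cls (xWords i) := rfl

theorem xWords_cons (n : ℕ) (i : List ℕ) : xWords (n :: i) = xWord n :: xWords i := rfl

theorem xWord_succ (n : ℕ) : xWord (n + 1) = Letter.x :: xWord n := rfl

theorem xWord_append (m n : ℕ) : xWord m ++ xWord n = xWord (m + n) :=
  List.replicate_append_replicate

theorem wwt_xWord (n : ℕ) : wwt (xWord n) = 0 := by simp [wwt, xWord, Letter.wt]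

theorem mwt_xWords (i : List ℕ) : mwt (xWords i) = 0 := by
  induction i with
  | nil => rfl
  | cons n i ih => rw [xWords_cons, mwt_cons, wwt_xWord, ih]

theorem mwt_append (A B : MultiWord) : mwt (A ++ B) = mwt A + mwt B := by simp [mwt]

theorem length_xWord (n : ℕ) : (xWord n).length = n := List.length_replicate

theorem eq_xWord_of_wwt_eq_zero {w : Word} (h : wwt w = 0) : w = xWord w.length := by
  induction w with
  | nil => rfl
  | cons l w ih =>
    rw [wwt_cons] at h
    cases l
    · rw [List.length_cons, xWord_succ, ← ih (by simpa [Letter.wt] using h)]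
    · simp [Letter.wt] at h

theorem exists_of_wwt_eq_one {w : Word} (h : wwt w = 1) :
    ∃ a b, w = xWord a ++ Letter.xi :: xWord b := by
  induction w with
  | nil => simp [wwt] at h
  | cons l w ih =>
    rw [wwt_cons] at h
    cases l
    · obtain ⟨a, b, rfl⟩ := ih (by simpa [Letter.wt] using h)
      exact ⟨a + 1, b, rfl⟩
    · exact ⟨0, w.length, by
        rw [← eq_xWord_of_wwt_eq_zero (w := w) (by simpa [Letter.wt] using h)]; rfl⟩

theorem exists_of_mwt_eq_zero {A : MultiWord} (h : mwt A = 0) : ∃ i, A = xWords i := by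
  induction A with
  | nil => exact ⟨[], rfl⟩
  | cons w A ih =>
    rw [mwt_cons] at h
    obtain ⟨i, rfl⟩ := ih (by omega)
    exact ⟨w.length :: i, by rw [xWords_cons, ← eq_xWord_of_wwt_eq_zero (w := w) (by omega)]⟩

theorem exists_of_mwt_eq_one {A : MultiWord} (h : mwt A = 1) :
    ∃ i a b j, A = xWords i ++ (xWord a ++ Letter.xi :: xWord b) :: xWords j := by
  induction A with
  | nil => simp [mwt] at h
  | cons w A ih =>
    rw [mwt_cons] at h
    by_cases hw : wwt w = 0
    · obtain ⟨i, a, b, j, rfl⟩ := ih (by omega)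
      exact ⟨w.length :: i, a, b, j, by
        rw [xWords_cons, ← eq_xWord_of_wwt_eq_zero hw, List.cons_append]⟩
    · obtain ⟨a, b, rfl⟩ := exists_of_wwt_eq_one (w := w) (by omega)
      obtain ⟨j, rfl⟩ := exists_of_mwt_eq_zero (A := A) (by omega)
      exact ⟨[], a, b, j, rfl⟩

theorem koszul_zero_left (n : ℕ) : koszul 0 n = 1 := by simp [koszul]

theorem koszul_zero_right (n : ℕ) : koszul n 0 = 1 := by simp [koszul]

/-- In degree `-1` every product of words is equivalent to one starting with a word `ξ x^b`. -/
theorem exists_cls_eq_of_mwt_eq_one {A : MultiWord} (h : mwt A = 1) :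
    ∃ b i, cls A = cls ((Letter.xi :: xWord b) :: xWords i) := by
  obtain ⟨i, a, b, j, rfl⟩ := exists_of_mwt_eq_one h
  -- Bring the word containing `ξ` to the front and rotate `x^a` to its end. Everything it passes
  -- has degree `0`, so no signs appear.
  refine ⟨b + a, i ++ j, ?_⟩
  rw [cls_move, cls_rotate, mwt_xWords, wwt_xWord, koszul_zero_left, koszul_zero_left, one_smul,
    one_smul, List.cons_append, xWord_append]
  simp only [xWords, List.map_append]

theorem splits_xWord (n : ℕ) :
    splits (xWord n) =
      (List.range n).map fun a => (xWord a, Letter.x, xWord (n - 1 - a)) := by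
  induction n with
  | zero => rfl
  | succ n ih =>
    rw [xWord_succ, splits, ih, List.range_succ_eq_map, List.map_cons, List.map_map, List.map_map]
    congr 1
    refine List.map_congr_left fun a _ => ?_
    simp only [Function.comp, xWord_succ, Nat.succ_eq_add_one]
    rw [show n + 1 - 1 - (a + 1) = n - 1 - a by omega]

theorem dWord_xWord (n : ℕ) : dWord (xWord n) = 0 := by
  rw [dWord, splits_xWord, List.map_map]
  exact List.sum_eq_zero (by simp [dLetter])

theorem dWord_xi (n : ℕ) :
    dWord (Letter.xi :: xWord n) = Finsupp.single (xWord (n + 1)) (-1) := by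
  rw [dWord, splits, splits_xWord, List.map_cons, List.sum_cons, List.map_map, List.map_map,
    List.sum_eq_zero (l := List.map _ (List.range n)) (by simp [dLetter]), add_zero]
  simp only [dLetter, Finsupp.mapDomain_single, wwt_nil, koszul_zero_right, one_smul]
  rfl

theorem cobracket_xWord (n : ℕ) : cobracket (xWord n) = 0 := by
  rw [cobracket, splits_xWord, List.map_map]
  refine List.sum_eq_zero ?_
  simp only [List.mem_map, Function.comp]
  rintro _ ⟨a, _, rfl⟩
  rw [splits_xWord, List.map_map]
  exact List.sum_eq_zero (by simp [cobracketTerm, form])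

/-- Only pairs containing `ξ` contract. Since `ξ` stands first, contracting it with an `x` cuts the
remaining letters into those before and those after that `x`; all Koszul signs involve a factor of
degree `0`. -/
theorem cobracket_xi (n : ℕ) :
    cobracket (Letter.xi :: xWord n) =
      ((List.range n).map fun a => Finsupp.single [xWord a, xWord (n - 1 - a)] (1 : ℂ)).sum := by
  rw [cobracket, splits, List.map_cons, List.sum_cons, List.map_map, splits_xWord, List.map_map,
    List.map_map]
  refine (congrArg₂ (· + ·) ?_ (List.sum_eq_zero ?_)).trans (add_zero _)
  · refine congrArg List.sum (List.map_congr_left fun a _ => ?_)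
    simp only [Function.comp, cobracketTerm, form, wwt_xWord, wwt_nil, koszul_zero_left,
      koszul_zero_right, List.append_nil, mul_one]
  · simp only [List.mem_map, Function.comp]
    rintro _ ⟨a, _, rfl⟩
    rw [splits_xWord, List.map_map]
    exact List.sum_eq_zero (by simp [cobracketTerm, form])

theorem dOne_xWord (n : ℕ) : dOne (xWord n) = 0 := by
  rw [dOne, dWord_xWord, cobracket_xWord, Finsupp.mapDomain_zero, add_zero]

theorem bracket_xWord (m n : ℕ) : bracket (xWord m) (xWord n) = 0 := by
  rw [bracket, splits_xWord m, List.map_map]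
  refine List.sum_eq_zero ?_
  simp only [List.mem_map, Function.comp]
  rintro _ ⟨a, _, rfl⟩
  rw [splits_xWord, List.map_map]
  exact List.sum_eq_zero (by simp [bracketTerm, form])

/-- Each of the `m` letters of `x^m` contracts with `ξ` and leaves the same word. For `m = 0` the
coefficient vanishes, so the truncated exponent does no harm. -/
theorem bracket_xi (n m : ℕ) :
    bracket (Letter.xi :: xWord n) (xWord m) = Finsupp.single (xWord (n + m - 1)) (m : ℂ) := by
  rw [bracket, splits, List.map_cons, List.sum_cons, List.map_map,
    List.sum_eq_zero (l := List.map (_ ∘ _) (splits (xWord n))), add_zero, splits_xWord,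
    List.map_map]
  · rw [List.map_congr_left (g := fun _ => Finsupp.single (xWord (n + m - 1)) (1 : ℂ))]
    · simp
    · intro a ha
      have ha := List.mem_range.1 ha
      simp only [Function.comp, bracketTerm, form, wwt_xWord, wwt_nil, koszul_zero_left,
        koszul_zero_right, List.append_nil, xWord_append, mul_one, Letter.wt, add_zero]
      congr 2
      omega
  · simp only [splits_xWord, List.mem_map, Function.comp]
    rintro _ ⟨_, ⟨a, _, rfl⟩, rfl⟩
    rw [List.map_map]
    exact List.sum_eq_zero (by simp [bracketTerm, form])

theorem bracketWith_xWord (n : ℕ) (i : List ℕ) : bracketWith (xWord n) (xWords i) = 0 := by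
  induction i with
  | nil => rfl
  | cons m i ih => simp [xWords_cons, bracketWith, ih, bracket_xWord]

theorem dMulti_xWords (i : List ℕ) : dMulti (xWords i) = 0 := by
  induction i with
  | nil => rfl
  | cons m i ih => simp [xWords_cons, dMulti, ih, dOne_xWord, bracketWith_xWord]

theorem differential_multiTraceCochain (i : List ℕ) : differential (multiTraceCochain i) = 0 := by
  rw [multiTraceCochain_eq, differential_cls, dMulti_xWords, map_zero]

theorem consQ_multiTraceCochain (n : ℕ) (i : List ℕ) :
    consQ (xWord n) (multiTraceCochain i) = multiTraceCochain (n :: i) :=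
  consQ_cls _ _

theorem mkQ_bracketWith_xi (n m : ℕ) (i : List ℕ) :
    relations.mkQ (bracketWith (Letter.xi :: xWord n) (xWords (m :: i))) =
      (m : ℂ) • multiTraceCochain ((n + m - 1) :: i) +
        consQ (xWord m) (relations.mkQ (bracketWith (Letter.xi :: xWord n) (xWords i))) := by
  rw [xWords_cons, mkQ_bracketWith_cons, bracket_xi, wwt_xWord, koszul_zero_right, one_smul,
    Finsupp.mapDomain_single, mkQ_single]
  rfl

/-- The loop equation in the complex. -/
theorem differential_xi (n : ℕ) (i : List ℕ) :
    differential (cls ((Letter.xi :: xWord n) :: xWords i)) =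
      ((List.range n).map fun a => multiTraceCochain (a :: (n - 1 - a) :: i)).sum +
        relations.mkQ (bracketWith (Letter.xi :: xWord n) (xWords i)) -
          multiTraceCochain ((n + 1) :: i) := by
  rw [differential_cls, mkQ_dMulti_cons, dMulti_xWords, map_zero, map_zero, smul_zero, add_zero,
    dOne, dWord_xi, cobracket_xi, Finsupp.mapDomain_add, map_add]
  simp only [← Finsupp.lmapDomain_apply ℂ ℂ, map_list_sum, List.map_map, Function.comp_def]
  simp only [Finsupp.lmapDomain_apply, Finsupp.mapDomain_single, mkQ_single, one_smul, neg_smul]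
  rw [neg_add_eq_sub, sub_add_eq_add_sub]
  rfl

/-! ### Reduction to polynomials in `ν` -/

/-- The elements cohomologous to a polynomial in `ν`. -/
noncomputable def nuReducible : Submodule ℂ SymCyc where
  carrier := {z | ∃ p : ℂ[X], Cohomologous z (ofNuPoly p)}
  zero_mem' := ⟨0, 0, by simp [ofNuPoly]⟩
  add_mem' := by
    rintro z w ⟨p, η, hη⟩ ⟨q, θ, hθ⟩
    refine ⟨p + q, η + θ, ?_⟩
    rw [map_add, hη, hθ, ofNuPoly, ofNuPoly, ofNuPoly,
      Polynomial.sum_add_index _ _ _ (by simp) (by simp [add_smul])]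
    abel
  smul_mem' := by
    rintro c z ⟨p, η, hη⟩
    refine ⟨c • p, c • η, ?_⟩
    rw [map_smul, hη, smul_sub, ofNuPoly, ofNuPoly, Polynomial.sum_smul_index' _ _ _ (by simp)]
    simp [Polynomial.sum, Finset.smul_sum, smul_smul]

theorem differential_mem_nuReducible (η : SymCyc) : differential η ∈ nuReducible :=
  ⟨0, η, by simp [ofNuPoly]⟩

theorem consQ_mem_span {m a : ℕ} {X : SymCyc}
    (hX : X ∈ Submodule.span ℂ (multiTraceCochain '' {L | L.sum < a})) :
    consQ (xWord m) X ∈ Submodule.span ℂ (multiTraceCochain '' {L | L.sum < m + a}) := by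
  revert X
  change Submodule.span ℂ _ ≤ (Submodule.span ℂ _).comap (consQ (xWord m))
  refine Submodule.span_le.2 ?_
  rintro _ ⟨L, hL, rfl⟩
  refine Submodule.subset_span ⟨m :: L, ?_, (consQ_multiTraceCochain m L).symm⟩
  simpa using hL

/-- A contraction merges `ξ x^n` with one `x^m` and deletes one `x`, so the total length drops
strictly. This is what the induction on total length needs from the bracket terms. -/
theorem bracketWith_xi_mem_span (n : ℕ) (i : List ℕ) :
    relations.mkQ (bracketWith (Letter.xi :: xWord n) (xWords i)) ∈
      Submodule.span ℂ (multiTraceCochain '' {L | L.sum < n + i.sum}) := by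
  induction i with
  | nil => exact (map_zero relations.mkQ).symm ▸ Submodule.zero_mem _
  | cons m i ih =>
    rw [mkQ_bracketWith_xi, List.sum_cons, add_left_comm]
    refine Submodule.add_mem _ ?_ (consQ_mem_span ih)
    rcases m with _ | m
    · simp
    · refine Submodule.smul_mem _ _ (Submodule.subset_span ⟨_, ?_, rfl⟩)
      simp only [Set.mem_ofPred_eq, List.sum_cons]
      omega

theorem multiTraceCochain_move (i : List ℕ) (n : ℕ) (j : List ℕ) :
    multiTraceCochain (i ++ n :: j) = multiTraceCochain (n :: (i ++ j)) := by
  have := cls_move (xWords i) (xWord n) (xWords j)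
  rw [mwt_xWords, koszul_zero_left, one_smul] at this
  simpa [multiTraceCochain_eq, xWords] using this

theorem ofNuPoly_monomial (m : ℕ) :
    ofNuPoly (Polynomial.X ^ m) = multiTraceCochain (List.replicate m 0) := by
  rw [ofNuPoly, Polynomial.X_pow_eq_monomial, Polynomial.sum_monomial_index _ _ (by simp),
    one_smul, multiTraceCochain_eq, xWords, List.map_replicate]
  rfl

/-- Every product of words `x^{i₁} ⋯ x^{i_k}` is cohomologous to a polynomial in `ν`. -/
theorem multiTraceCochain_mem (i : List ℕ) : multiTraceCochain i ∈ nuReducible := by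
  induction h : i.sum using Nat.strong_induction_on generalizing i with
  | _ s ih =>
    subst h
    -- If all words are empty, the product is already a power of `ν`.
    by_cases hi : ∀ n ∈ i, n = 0
    · rw [List.eq_replicate_of_mem hi, ← ofNuPoly_monomial]
      exact ⟨_, 0, (map_zero _).trans (sub_self _).symm⟩
    · push Not at hi
      obtain ⟨n, hn, hn0⟩ := hi
      obtain ⟨i, j, rfl⟩ := List.append_of_mem hn
      obtain ⟨n, rfl⟩ := Nat.exists_eq_succ_of_ne_zero hn0
      -- Solve the loop equation for its last term `(x^{n+1}) B`: it equals the cobracket and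
      -- bracket terms, all of smaller total length, minus a coboundary.
      rw [multiTraceCochain_move, Nat.succ_eq_add_one, ← sub_sub_cancel
        (((List.range n).map fun a => multiTraceCochain (a :: (n - 1 - a) :: (i ++ j))).sum +
          relations.mkQ (bracketWith (Letter.xi :: xWord n) (xWords (i ++ j))))
        (multiTraceCochain ((n + 1) :: (i ++ j))), ← differential_xi]
      refine Submodule.sub_mem _ (Submodule.add_mem _ (list_sum_mem ?_) ?_)
        (differential_mem_nuReducible _)
      · intro z hz
        obtain ⟨a, ha, rfl⟩ := List.mem_map.1 hz
        have := List.mem_range.1 ha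
        refine ih _ ?_ _ rfl
        simp only [List.sum_cons, List.sum_append]
        omega
      · refine Submodule.span_le.2 ?_ (bracketWith_xi_mem_span n (i ++ j))
        rintro _ ⟨L, hL, rfl⟩
        refine ih _ ?_ _ rfl
        simp only [Set.mem_ofPred_eq, List.sum_cons, List.sum_append] at hL ⊢
        omega

/-! ### The differential lowers the degree of products of words by one -/

/-- The form pairs only `x` with `ξ`, so a contraction removes exactly one `ξ`. The exact count, not
just its parity, is needed to discard all degrees but one after evaluation. -/
theorem bracket_mem_wwt (u v : Word) :
    bracket u v ∈ Finsupp.supported ℂ ℂ {w : Word | wwt w + 1 = wwt u + wwt v} := by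
  refine list_sum_mem ?_
  intro x hx
  obtain ⟨q, hq, rfl⟩ := List.mem_map.1 hx
  refine list_sum_mem ?_
  intro x hx
  obtain ⟨p, hp, rfl⟩ := List.mem_map.1 hx
  by_cases hf : form q.2.1 p.2.1 = 0
  · simp [bracketTerm, hf]
  · refine Finsupp.single_mem_supported _ _ ?_
    have := form_parity hf
    have := wwt_of_mem_splits hq
    have := wwt_of_mem_splits hp
    simp only [Set.mem_ofPred_eq, wwt_append]
    omega

theorem dOne_mem_mwt (w : Word) :
    dOne w ∈ Finsupp.supported ℂ ℂ {A : MultiWord | mwt A + 1 = wwt w} := by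
  refine Submodule.add_mem _ ?_ ?_
  · rw [← Finsupp.lmapDomain_apply ℂ ℂ, dWord, map_list_sum, List.map_map]
    refine list_sum_mem ?_
    intro x hx
    obtain ⟨⟨s, l, t⟩, hq, rfl⟩ := List.mem_map.1 hx
    have hw := wwt_of_mem_splits hq
    simp only [Function.comp, map_smul]
    refine Submodule.smul_mem _ _ ?_
    cases l
    · simp [dLetter]
    · simp only [dLetter, Finsupp.mapDomain_single, Finsupp.lmapDomain_apply]
      refine Finsupp.single_mem_supported _ _ ?_
      simp only [Set.mem_ofPred_eq, mwt, List.map_cons, List.map_nil, List.sum_cons, List.sum_nil,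
        hw, wwt_append, wwt_cons, Letter.wt]
      omega
  · refine list_sum_mem ?_
    intro x hx
    obtain ⟨q, hq, rfl⟩ := List.mem_map.1 hx
    refine list_sum_mem ?_
    intro x hx
    obtain ⟨p, hp, rfl⟩ := List.mem_map.1 hx
    have hw := wwt_of_mem_splits hq
    have hw' := wwt_of_mem_splits hp
    by_cases hf : form q.2.1 p.2.1 = 0
    · simp [cobracketTerm, hf]
    · refine Finsupp.single_mem_supported _ _ ?_
      have := form_parity hf
      simp only [Set.mem_ofPred_eq, mwt, List.map_cons, List.map_nil, List.sum_cons, List.sum_nil,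
        wwt_append]
      omega

theorem mapDomain_mem_supported {α β : Type*} {s : Set α} {t : Set β} {f : α → β} {X : α →₀ ℂ}
    (hX : X ∈ Finsupp.supported ℂ ℂ s) (h : Set.MapsTo f s t) :
    X.mapDomain f ∈ Finsupp.supported ℂ ℂ t := by
  refine Finsupp.supported_mono h.image_subset ?_
  rw [← Finsupp.lmapDomain_supported]
  exact ⟨X, hX, rfl⟩

theorem bracketWith_mem_mwt (u : Word) (B : MultiWord) :
    bracketWith u B ∈ Finsupp.supported ℂ ℂ {A : MultiWord | mwt A + 1 = wwt u + mwt B} := by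
  induction B with
  | nil => exact Submodule.zero_mem _
  | cons v B ih =>
    refine Submodule.add_mem _ (mapDomain_mem_supported (bracket_mem_wwt u v) ?_)
      (Submodule.smul_mem _ _ (mapDomain_mem_supported ih ?_)) <;>
    · intro A hA
      simp only [Set.mem_ofPred_eq, mwt_cons] at hA ⊢
      omega

theorem dMulti_mem_mwt (B : MultiWord) :
    dMulti B ∈ Finsupp.supported ℂ ℂ {A : MultiWord | mwt A + 1 = mwt B} := by
  induction B with
  | nil => exact Submodule.zero_mem _
  | cons v B ih =>
    refine Submodule.add_mem _ (Submodule.add_mem _ (mapDomain_mem_supported (dOne_mem_mwt v) ?_)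
      ?_) (Submodule.smul_mem _ _ (mapDomain_mem_supported ih ?_))
    · intro A hA
      simp only [Set.mem_ofPred_eq, mwt_cons, mwt_append] at hA ⊢
      omega
    · rw [mwt_cons]
      exact bracketWith_mem_mwt v B
    · intro A hA
      simp only [Set.mem_ofPred_eq, mwt_cons] at hA ⊢
      omega

/-! ### Evaluation at a matrix -/

section Eval

variable {N : ℕ} (X : Matrix (Fin N) (Fin N) ℂ)

theorem multiTrace_cons (n : ℕ) (i : List ℕ) :
    multiTrace (n :: i) X = (X ^ n).trace * multiTrace i X := rfl

theorem multiTrace_append (i j : List ℕ) :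
    multiTrace (i ++ j) X = multiTrace i X * multiTrace j X := by simp [multiTrace]

/-- The value of a product of words at `x = X`, `ξ = 0`. -/
noncomputable def evalMulti (A : MultiWord) : ℂ :=
  if mwt A = 0 then multiTrace (A.map List.length) X else 0

/-- Evaluation of cyclic words at `x = X`, `ξ = 0`, where `(x^n)` becomes `Tr(X^n)`. -/
noncomputable def evalAt : SymCyc →ₗ[ℂ] ℂ :=
  relations.liftQ (Finsupp.linearCombination ℂ (evalMulti X)) (relations_le_ker _
    (fun A l w B => by
      simp only [Finsupp.linearCombination_single, smul_eq_mul, evalMulti, mwt_append,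
        mwt_cons, wwt_append, wwt_cons, wwt_nil]
      -- Moving an `x` costs no sign and preserves lengths; if the letter is `ξ`, both sides contain
      -- a `ξ` and evaluate to `0`.
      by_cases h : l.wt = 0
      · simp [h, koszul_zero_left]
      · rw [if_neg (by omega), if_neg (by omega)]
        simp)
    (fun A u v B => by
      simp only [Finsupp.linearCombination_single, smul_eq_mul, evalMulti, mwt_append,
        mwt_cons]
      -- If `u` has no `ξ`, the sign is `1` and the traces commute; otherwise both sides are `0`.
      by_cases h : wwt u = 0
      · simp [h, koszul_zero_left, multiTrace_append, multiTrace_cons, mul_left_comm]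
      · rw [if_neg (by omega), if_neg (by omega)]
        simp))

theorem evalAt_cls (A : MultiWord) : evalAt X (cls A) = evalMulti X A := by
  change Finsupp.linearCombination ℂ (evalMulti X) (Finsupp.single A 1) = _
  rw [Finsupp.linearCombination_single, one_smul]

theorem evalAt_multiTraceCochain (i : List ℕ) :
    evalAt X (multiTraceCochain i) = multiTrace i X := by
  rw [multiTraceCochain_eq, evalAt_cls, evalMulti, if_pos (mwt_xWords i), xWords, List.map_map]
  congr 1
  exact (List.map_congr_left fun n _ => length_xWord n).trans (List.map_id i)

/-- The empty word becomes `Tr(X^0) = N`, so the value does not depend on `X` and can leave the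
integral. -/
theorem evalAt_ofNuPoly (p : ℂ[X]) : evalAt X (ofNuPoly p) = p.eval (N : ℂ) := by
  rw [ofNuPoly, Polynomial.sum, map_sum, Polynomial.eval_eq_sum, Polynomial.sum]
  refine Finset.sum_congr rfl fun m _ => ?_
  have h : cls (List.replicate m []) = multiTraceCochain (List.replicate m 0) := by
    rw [multiTraceCochain_eq, xWords, List.map_replicate]
    rfl
  rw [map_smul, h, evalAt_multiTraceCochain]
  simp [multiTrace]

theorem evalAt_consQ (n : ℕ) (z : SymCyc) :
    evalAt X (consQ (xWord n) z) = (X ^ n).trace * evalAt X z := by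
  obtain ⟨z, rfl⟩ := relations.mkQ_surjective z
  induction z using Finsupp.induction_linear with
  | zero => simp
  | add z w hz hw => rw [map_add, map_add, map_add, hz, hw, map_add, mul_add]
  | single A c =>
    rw [mkQ_single, map_smul, map_smul, map_smul, consQ_cls, evalAt_cls, evalAt_cls]
    simp only [evalMulti]
    rw [mwt_cons, wwt_xWord, zero_add, List.map_cons, length_xWord, multiTrace_cons]
    split_ifs <;> simp [mul_left_comm]

theorem evalAt_mkQ_of_mwt_ne_zero {Y : Pre}
    (hY : Y ∈ Finsupp.supported ℂ ℂ {A : MultiWord | mwt A ≠ 0}) :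
    evalAt X (relations.mkQ Y) = 0 := by
  change Finsupp.linearCombination ℂ (evalMulti X) Y = 0
  rw [Finsupp.linearCombination_apply]
  exact Finset.sum_eq_zero fun A hA => by
    simp only [evalMulti]
    rw [if_neg (hY hA), smul_zero]

/-- Evaluation sees only products without `ξ`, and the differential removes exactly one `ξ`. -/
theorem evalAt_differential_of_mwt_ne_one {A : MultiWord} (h : mwt A ≠ 1) :
    evalAt X (differential (cls A)) = 0 := by
  rw [differential_cls]
  refine evalAt_mkQ_of_mwt_ne_zero X (Finsupp.supported_mono ?_ (dMulti_mem_mwt A))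
  intro C hC
  simp only [Set.mem_ofPred_eq] at hC ⊢
  omega

/-- The value at `X` of the bracket of `ξ x^n` with `x^{i₁} ⋯ x^{i_k}`. -/
noncomputable def bracketTrace (n : ℕ) : List ℕ → ℂ
  | [] => 0
  | m :: i => m * (X ^ (n + m - 1)).trace * multiTrace i X + (X ^ m).trace * bracketTrace n i

theorem evalAt_bracketWith (n : ℕ) (i : List ℕ) :
    evalAt X (relations.mkQ (bracketWith (Letter.xi :: xWord n) (xWords i))) =
      bracketTrace X n i := by
  induction i with
  | nil => exact (congrArg _ (map_zero relations.mkQ)).trans (map_zero _)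
  | cons m i ih =>
    rw [mkQ_bracketWith_xi, map_add, map_smul, evalAt_multiTraceCochain, evalAt_consQ, ih,
      multiTrace_cons, smul_eq_mul, bracketTrace, mul_assoc]

theorem evalAt_differential_xi (n : ℕ) (i : List ℕ) :
    evalAt X (differential (cls ((Letter.xi :: xWord n) :: xWords i))) =
      (∑ a ∈ Finset.range n, (X ^ a).trace * (X ^ (n - 1 - a)).trace) * multiTrace i X +
        bracketTrace X n i - (X ^ (n + 1)).trace * multiTrace i X := by
  rw [differential_xi, map_sub, map_add, evalAt_bracketWith, evalAt_multiTraceCochain,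
    multiTrace_cons, map_list_sum, List.map_map, Finset.sum_mul, Finset.sum_range]
  rw [← List.sum_ofFn, List.ofFn_eq_map, ← List.map_coe_finRange_eq_range, List.map_map]
  simp [Function.comp_def, evalAt_multiTraceCochain, multiTrace_cons, mul_assoc]

end Eval

end NCBV

namespace NCBV

/-! ### Directional derivatives of trace polynomials -/

section Derivative

variable {N : ℕ} (X V : Matrix (Fin N) (Fin N) ℂ)

/-- The derivative of `X^n` in the direction `V`. -/
noncomputable def powDeriv (n : ℕ) : Matrix (Fin N) (Fin N) ℂ :=
  ∑ a ∈ Finset.range n, X ^ (n - 1 - a) * V * X ^ a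

/-- The derivative of `Tr(X^{i₁}) ⋯ Tr(X^{i_k})` in the direction `V`. -/
noncomputable def multiTraceDeriv : List ℕ → ℂ
  | [] => 0
  | m :: i =>
    m * (X ^ (m - 1) * V).trace * multiTrace i X + (X ^ m).trace * multiTraceDeriv i

theorem hasDerivAt_pow_apply (n : ℕ) (i j : Fin N) :
    HasDerivAt (fun t : ℝ => ((X + t • V) ^ n) i j) (powDeriv X V n i j) 0 := by
  -- A submultiplicative norm is chosen locally so that the power rule in a noncommutative normed
  -- algebra applies; the entrywise conclusion does not depend on it.
  let _ := Matrix.linftyOpNormedRing (n := Fin N) (α := ℂ)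
  let _ := Matrix.linftyOpNormedAlgebra (n := Fin N) (R := ℝ) (α := ℂ)
  have h := ((hasDerivAt_id (0 : ℝ)).smul_const V).const_add X
  simp only [id, one_smul] at h
  have h' := h.fun_pow' n
  simp only [zero_smul, add_zero] at h'
  exact hasDerivAt_pi.1 (hasDerivAt_pi.1 h' i) j

theorem trace_powDeriv (n : ℕ) : (powDeriv X V n).trace = n * (X ^ (n - 1) * V).trace := by
  rw [powDeriv, Matrix.trace_sum, Finset.sum_congr rfl (g := fun _ => (X ^ (n - 1) * V).trace)]
  · simp
  · intro a ha
    have := Finset.mem_range.1 ha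
    rw [Matrix.trace_mul_comm, ← mul_assoc, ← pow_add, show a + (n - 1 - a) = n - 1 by omega]

theorem hasDerivAt_trace_pow (n : ℕ) :
    HasDerivAt (fun t : ℝ => ((X + t • V) ^ n).trace) (n * (X ^ (n - 1) * V).trace) 0 := by
  rw [← trace_powDeriv]
  exact HasDerivAt.fun_sum fun i _ => hasDerivAt_pow_apply X V n i i

theorem hasDerivAt_multiTrace (i : List ℕ) :
    HasDerivAt (fun t : ℝ => multiTrace i (X + t • V)) (multiTraceDeriv X V i) 0 := by
  induction i with
  | nil => exact hasDerivAt_const _ _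
  | cons m i ih =>
    simpa [multiTraceDeriv, multiTrace_cons] using (hasDerivAt_trace_pow X V m).fun_mul ih

theorem hasDerivAt_gaussWeight :
    HasDerivAt (fun t : ℝ => gaussWeight (X + t • V)) (-(X * V).trace * gaussWeight X) 0 := by
  have := ((hasDerivAt_trace_pow X V 2).const_mul (-(1 / 2) : ℂ)).cexp
  refine this.congr_deriv ?_
  simp [gaussWeight]
  ring

/-- The integrand of the Schwinger–Dyson equation for `(X^n)_{kl} Tr(X^{i₁}) ⋯ Tr(X^{i_k})` in the
direction `V`. -/
noncomputable def schwingerDyson (n : ℕ) (i : List ℕ) (k l : Fin N) : ℂ :=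
  powDeriv X V n k l * multiTrace i X + (X ^ n) k l * multiTraceDeriv X V i -
    (X ^ n) k l * multiTrace i X * (X * V).trace

/-! ### Linearity in the direction, and summation over elementary matrices -/

variable (W : Matrix (Fin N) (Fin N) ℂ) (c : ℂ)

theorem powDeriv_add_smul (n : ℕ) :
    powDeriv X (V + c • W) n = powDeriv X V n + c • powDeriv X W n := by
  simp [powDeriv, mul_add, add_mul, Finset.sum_add_distrib, Finset.smul_sum]

theorem multiTraceDeriv_add_smul (i : List ℕ) :
    multiTraceDeriv X (V + c • W) i = multiTraceDeriv X V i + c * multiTraceDeriv X W i := by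
  induction i with
  | nil => simp [multiTraceDeriv]
  | cons m i ih =>
    simp only [multiTraceDeriv, ih, mul_add, Matrix.trace_add, Matrix.mul_smul, Matrix.trace_smul,
      smul_eq_mul]
    ring

/-- Linearity over `ℂ` is the point: integration by parts is available only in Hermitian directions,
whereas the loop equation uses elementary matrices. -/
theorem schwingerDyson_add_smul (n : ℕ) (i : List ℕ) (k l : Fin N) :
    schwingerDyson X (V + c • W) n i k l =
      schwingerDyson X V n i k l + c * schwingerDyson X W n i k l := by
  simp only [schwingerDyson, powDeriv_add_smul, multiTraceDeriv_add_smul, mul_add,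
    Matrix.trace_add, Matrix.mul_smul, Matrix.trace_smul, smul_eq_mul, Matrix.add_apply,
    Matrix.smul_apply]
  ring

theorem mul_single_mul_apply (A B : Matrix (Fin N) (Fin N) ℂ) (i j k l : Fin N) :
    (A * (Matrix.single i j 1 : Matrix (Fin N) (Fin N) ℂ) * B) k l = A k i * B j l := by
  rw [mul_assoc, Matrix.mul_apply, Finset.sum_eq_single i]
  · simp
  · intro a _ ha
    rw [Matrix.single_mul_apply_of_ne _ _ _ _ _ ha, mul_zero]
  · simp

/-- The `(k, l)` entry of `A E_{kl} B` is `A_{kk} B_{ll}`, so the double sum factors into two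
traces. This is the matrix counterpart of the cobracket. -/
theorem sum_powDeriv (n : ℕ) :
    ∑ k, ∑ l, powDeriv X (Matrix.single k l 1) n k l =
      ∑ a ∈ Finset.range n, (X ^ a).trace * (X ^ (n - 1 - a)).trace := by
  simp only [powDeriv, Matrix.sum_apply, mul_single_mul_apply]
  rw [Finset.sum_congr rfl fun k _ => Finset.sum_comm, Finset.sum_comm]
  refine Finset.sum_congr rfl fun a _ => ?_
  rw [mul_comm, Matrix.trace, Matrix.trace, Finset.sum_mul_sum]
  rfl

/-- Since `Σ A_{kl} E_{kl} = A`, the sum glues `A` into the trace. This is the counterpart of the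
bracket, and with `B = X` it also produces the term coming from `dξ = -x`. -/
theorem sum_mul_trace (A B : Matrix (Fin N) (Fin N) ℂ) :
    ∑ k, ∑ l, A k l * (B * Matrix.single k l 1).trace = (A * B).trace := by
  simp only [Matrix.trace_mul_single, MulOpposite.op_one, one_smul]
  simp only [Matrix.trace, Matrix.diag_apply, Matrix.mul_apply]

theorem sum_multiTraceDeriv (n : ℕ) (i : List ℕ) :
    ∑ k, ∑ l, (X ^ n) k l * multiTraceDeriv X (Matrix.single k l 1) i = bracketTrace X n i := by
  induction i with
  | nil => simp [multiTraceDeriv, bracketTrace]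
  | cons m i ih =>
    -- The factor `m` is needed: for `m = 0` the truncated exponents on the two sides differ in
    -- general.
    have h : (m : ℂ) * (X ^ (n + m - 1)).trace = m * (X ^ n * X ^ (m - 1)).trace := by
      rcases m with _ | m
      · simp
      · rw [← pow_add]
        rfl
    rw [bracketTrace, ← ih, h, ← sum_mul_trace]
    simp only [multiTraceDeriv, mul_add, Finset.sum_add_distrib, Finset.mul_sum, Finset.sum_mul]
    congr 1 <;> refine Finset.sum_congr rfl fun k _ => Finset.sum_congr rfl fun l _ => ?_ <;> ring

theorem sum_schwingerDyson (n : ℕ) (i : List ℕ) :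
    ∑ k, ∑ l, schwingerDyson X (Matrix.single k l 1) n i k l =
      evalAt X (differential (cls ((Letter.xi :: xWord n) :: xWords i))) := by
  rw [evalAt_differential_xi, ← sum_powDeriv, ← sum_multiTraceDeriv, pow_succ X n,
    ← sum_mul_trace (X ^ n) X]
  simp only [schwingerDyson, Finset.sum_add_distrib, Finset.sum_sub_distrib, Finset.sum_mul]
  congr 1
  exact Finset.sum_congr rfl fun k _ => Finset.sum_congr rfl fun l _ => by ring

end Derivative

/-! ### Gaussian integrals of functions of temperate growth -/

section Gaussian

open MeasureTheory Function

variable {N n : ℕ} (φ : (Fin n → ℝ) ≃ₗ[ℝ] Herm N)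

/-- Entries are linear in the coordinates. Temperate growth is stable under sums and products, so it
covers every polynomial integrand below, and integrability against the Gaussian is proved once for
the whole class. -/
theorem hasTemperateGrowth_entry (i j : Fin N) :
    HasTemperateGrowth fun y => (φ y : Matrix (Fin N) (Fin N) ℂ) i j := by
  let f : (Fin n → ℝ) →ₗ[ℝ] ℂ :=
    { toFun := fun y => (φ y : Matrix (Fin N) (Fin N) ℂ) i j
      map_add' := fun y z => by simp
      map_smul' := fun c y => by simp }
  exact (LinearMap.toContinuousLinearMap f).hasTemperateGrowth

theorem hasTemperateGrowth_pow (m : ℕ) (i j : Fin N) :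
    HasTemperateGrowth fun y => ((φ y : Matrix (Fin N) (Fin N) ℂ) ^ m) i j := by
  induction m generalizing i j with
  | zero => simp
  | succ m ih =>
    simp only [pow_succ, Matrix.mul_apply]
    exact HasTemperateGrowth.sum fun k _ => (ih i k).mul (hasTemperateGrowth_entry φ k j)

theorem hasTemperateGrowth_trace_pow (m : ℕ) :
    HasTemperateGrowth fun y => ((φ y : Matrix (Fin N) (Fin N) ℂ) ^ m).trace :=
  HasTemperateGrowth.sum fun k _ => hasTemperateGrowth_pow φ m k k

theorem hasTemperateGrowth_multiTrace (i : List ℕ) :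
    HasTemperateGrowth fun y => multiTrace i (φ y : Matrix (Fin N) (Fin N) ℂ) := by
  induction i with
  | nil => exact HasTemperateGrowth.const 1
  | cons m i ih => exact (hasTemperateGrowth_trace_pow φ m).mul ih

theorem hasTemperateGrowth_trace_pow_mul (m : ℕ) (V : Matrix (Fin N) (Fin N) ℂ) :
    HasTemperateGrowth fun y => ((φ y : Matrix (Fin N) (Fin N) ℂ) ^ m * V).trace := by
  simp only [Matrix.trace, Matrix.diag_apply, Matrix.mul_apply]
  exact HasTemperateGrowth.sum fun k _ => HasTemperateGrowth.sum fun l _ =>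
    (hasTemperateGrowth_pow φ m k l).mul (HasTemperateGrowth.const _)

theorem hasTemperateGrowth_multiTraceDeriv (V : Matrix (Fin N) (Fin N) ℂ) (i : List ℕ) :
    HasTemperateGrowth fun y => multiTraceDeriv (φ y : Matrix (Fin N) (Fin N) ℂ) V i := by
  induction i with
  | nil => exact HasTemperateGrowth.zero
  | cons m i ih =>
    exact (((HasTemperateGrowth.const _).mul (hasTemperateGrowth_trace_pow_mul φ _ V)).mul
      (hasTemperateGrowth_multiTrace φ i)).add ((hasTemperateGrowth_trace_pow φ m).mul ih)

theorem hasTemperateGrowth_powDeriv (V : Matrix (Fin N) (Fin N) ℂ) (m : ℕ) (k l : Fin N) :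
    HasTemperateGrowth fun y => powDeriv (φ y : Matrix (Fin N) (Fin N) ℂ) V m k l := by
  simp only [powDeriv, Matrix.sum_apply, Matrix.mul_apply]
  exact HasTemperateGrowth.sum fun a _ => HasTemperateGrowth.sum fun p _ =>
    (HasTemperateGrowth.sum fun q _ =>
      (hasTemperateGrowth_pow φ _ _ _).mul (HasTemperateGrowth.const _)).mul
      (hasTemperateGrowth_pow φ _ _ _)

/-- Hermitian symmetry turns `X_{ij} X_{ji}` into `|X_{ij}|²`, so the quadratic form in the exponent
is real and positive definite. -/
theorem trace_sq_eq (y : Fin n → ℝ) :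
    ((φ y : Matrix (Fin N) (Fin N) ℂ) ^ 2).trace =
      ((∑ i, ∑ j, ‖(φ y : Matrix (Fin N) (Fin N) ℂ) i j‖ ^ 2 : ℝ) : ℂ) := by
  have h : ∀ i j, (φ y : Matrix (Fin N) (Fin N) ℂ) j i =
      (starRingEnd ℂ) ((φ y : Matrix (Fin N) (Fin N) ℂ) i j) := fun i j =>
    (congrFun (congrFun (φ y).2 j) i).symm
  simp only [pow_two, Matrix.trace, Matrix.diag_apply, Matrix.mul_apply, Complex.ofReal_sum]
  refine Finset.sum_congr rfl fun i _ => Finset.sum_congr rfl fun j _ => ?_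
  rw [h i j, Complex.mul_conj, Complex.normSq_eq_norm_sq, pow_two]

theorem gaussWeight_eq (y : Fin n → ℝ) :
    gaussWeight (φ y : Matrix (Fin N) (Fin N) ℂ) =
      (Real.exp (-(1 / 2) * ∑ i, ∑ j, ‖(φ y : Matrix (Fin N) (Fin N) ℂ) i j‖ ^ 2) : ℝ) := by
  rw [gaussWeight, trace_sq_eq]
  push_cast
  rfl

theorem exists_norm_gaussWeight_le :
    ∃ c > 0, ∀ y, ‖gaussWeight (φ y : Matrix (Fin N) (Fin N) ℂ)‖ ≤ Real.exp (-c * ‖y‖ ^ 2) := by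
  let f : (Fin n → ℝ) →ₗ[ℝ] (Fin N → Fin N → ℂ) :=
    { toFun := fun y i j => (φ y : Matrix (Fin N) (Fin N) ℂ) i j
      map_add' := fun y z => by ext; simp
      map_smul' := fun c y => by ext; simp }
  have hf : LinearMap.ker f = ⊥ := LinearMap.ker_eq_bot.2 fun y z h =>
    φ.injective (Subtype.ext h)
  obtain ⟨K, hK, hK'⟩ := f.exists_antilipschitzWith hf
  -- An injective linear map from a finite-dimensional space is antilipschitz, so `‖y‖² ≤ K²
  -- Tr(X²)`; halving gives the constant.
  refine ⟨1 / (2 * K ^ 2), by positivity, fun y => ?_⟩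
  rw [gaussWeight_eq, Complex.norm_real, Real.norm_of_nonneg (Real.exp_nonneg _)]
  refine Real.exp_le_exp.2 ?_
  have h1 : ‖y‖ ≤ K * ‖f y‖ := by simpa using hK'.le_mul_dist y 0
  set S := ∑ i, ∑ j, ‖(φ y : Matrix (Fin N) (Fin N) ℂ) i j‖ ^ 2 with hS
  have h2 : ‖f y‖ ≤ √S := by
    refine (pi_norm_le_iff_of_nonneg (Real.sqrt_nonneg _)).2 fun i =>
      (pi_norm_le_iff_of_nonneg (Real.sqrt_nonneg _)).2 fun j => Real.le_sqrt_of_sq_le ?_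
    refine le_trans ?_ (Finset.single_le_sum (fun i _ => Finset.sum_nonneg fun j _ => sq_nonneg _)
      (Finset.mem_univ i))
    exact Finset.single_le_sum (f := fun j => ‖(φ y : Matrix (Fin N) (Fin N) ℂ) i j‖ ^ 2)
      (fun j _ => sq_nonneg _) (Finset.mem_univ j)
  have hS0 : 0 ≤ S := Finset.sum_nonneg fun i _ => Finset.sum_nonneg fun j _ => sq_nonneg _
  have h3 : ‖y‖ ^ 2 ≤ K ^ 2 * S := by
    calc ‖y‖ ^ 2 ≤ (K * √S) ^ 2 := by gcongr; exact h1.trans (by gcongr)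
      _ = K ^ 2 * S := by rw [mul_pow, Real.sq_sqrt hS0]
  have hK2 : (0 : ℝ) < 2 * K ^ 2 := by positivity
  have h4 : 1 / (2 * (K : ℝ) ^ 2) * ‖y‖ ^ 2 ≥ 0 := by positivity
  have h5 : 1 / (2 * (K : ℝ) ^ 2) * ‖y‖ ^ 2 ≤ 1 / (2 * (K : ℝ) ^ 2) * (K ^ 2 * S) := by gcongr
  have h6 : 1 / (2 * (K : ℝ) ^ 2) * (K ^ 2 * S) = 1 / 2 * S := by field_simp
  linarith

theorem pow_mul_exp_neg_sq_le {c : ℝ} (hc : 0 < c) (m : ℕ) :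
    ∃ C : ℝ, ∀ t : ℝ, 0 ≤ t → (1 + t) ^ m * Real.exp (-c * t ^ 2) ≤ C := by
  -- The power is bounded by one term of the series of `exp (c/2 * (1 + t))`, and this exponential
  -- is absorbed by the Gaussian because `t² - t/2 + 1/2 ≥ 0`; a factor `exp c` remains.
  refine ⟨m.factorial * (2 / c) ^ m * Real.exp c, fun t ht => ?_⟩
  have h1 := Real.pow_div_factorial_le_exp (c / 2 * (1 + t)) (by positivity) m
  have h2 : -c * t ^ 2 ≤ c - c / 2 * (1 + t) := by nlinarith [sq_nonneg (t - 1 / 4)]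
  have hm : (0 : ℝ) < m.factorial := by positivity
  have h3 : (1 + t) ^ m ≤ m.factorial * (2 / c) ^ m * Real.exp (c / 2 * (1 + t)) := by
    calc (1 + t) ^ m
        = m.factorial * (2 / c) ^ m * ((c / 2 * (1 + t)) ^ m / m.factorial) := by
          rw [mul_pow, div_pow, div_pow]; field_simp
      _ ≤ _ := by gcongr
  calc (1 + t) ^ m * Real.exp (-c * t ^ 2)
      ≤ m.factorial * (2 / c) ^ m * Real.exp (c / 2 * (1 + t)) *
          Real.exp (c - c / 2 * (1 + t)) := by gcongr
    _ = m.factorial * (2 / c) ^ m * Real.exp c := by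
      rw [mul_assoc _ (Real.exp _), ← Real.exp_add]; congr 2; ring

theorem continuous_gaussWeight :
    Continuous fun y => gaussWeight (φ y : Matrix (Fin N) (Fin N) ℂ) :=
  Complex.continuous_exp.comp
    (continuous_const.mul (hasTemperateGrowth_trace_pow φ 2).1.continuous)

theorem integrable_mul_gaussWeight {F : (Fin n → ℝ) → ℂ} (hF : HasTemperateGrowth F) :
    Integrable fun y => F y * gaussWeight (φ y : Matrix (Fin N) (Fin N) ℂ) := by
  obtain ⟨c, hc, hg⟩ := exists_norm_gaussWeight_le φ
  obtain ⟨k, C, hC⟩ := hF.2 0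
  -- Beyond the growth exponent `k` of `F`, another `n + 1` powers are spent on the decay `(1 +
  -- ‖y‖)^{-(n+1)}`, which is integrable in dimension `n`.
  obtain ⟨D, hD⟩ := pow_mul_exp_neg_sq_le hc (k + (n + 1))
  have hr : (Module.finrank ℝ (Fin n → ℝ) : ℝ) < ((n + 1 : ℕ) : ℝ) := by
    rw [Module.finrank_fin_fun]
    exact_mod_cast n.lt_succ_self
  refine ((integrable_one_add_norm (μ := volume) hr).const_mul (|C| * D)).mono'
    (hF.1.continuous.mul (continuous_gaussWeight φ)).aestronglyMeasurable (ae_of_all _ fun y => ?_)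
  have h1 := hC y
  rw [norm_iteratedFDeriv_zero] at h1
  have hy : 0 < 1 + ‖y‖ := by positivity
  have h2 : (1 + ‖y‖) ^ k * Real.exp (-c * ‖y‖ ^ 2) ≤ D * (1 + ‖y‖) ^ (-((n + 1 : ℕ) : ℝ)) := by
    rw [Real.rpow_neg hy.le, Real.rpow_natCast, ← div_eq_mul_inv, le_div_iff₀ (by positivity)]
    refine le_trans (le_of_eq ?_) (hD ‖y‖ (norm_nonneg y))
    rw [pow_add]
    ring
  calc ‖F y * gaussWeight (φ y : Matrix (Fin N) (Fin N) ℂ)‖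
      ≤ C * (1 + ‖y‖) ^ k * Real.exp (-c * ‖y‖ ^ 2) := by
        rw [norm_mul]
        exact mul_le_mul h1 (hg y) (norm_nonneg _) ((norm_nonneg _).trans h1)
    _ ≤ |C| * (1 + ‖y‖) ^ k * Real.exp (-c * ‖y‖ ^ 2) := by gcongr; exact le_abs_self C
    _ ≤ |C| * D * (1 + ‖y‖) ^ (-((n + 1 : ℕ) : ℝ)) := by
        rw [mul_assoc, mul_assoc]
        gcongr

theorem integral_gaussWeight_ne_zero :
    (∫ y, gaussWeight (φ y : Matrix (Fin N) (Fin N) ℂ)) ≠ 0 := by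
  have h : Integrable fun y => gaussWeight (φ y : Matrix (Fin N) (Fin N) ℂ) := by
    simpa using integrable_mul_gaussWeight φ (HasTemperateGrowth.const 1)
  simp only [gaussWeight_eq] at h ⊢
  rw [integral_complex_ofReal, Complex.ofReal_ne_zero]
  refine (integral_exp_pos ?_).ne'
  exact h.re

/-! ### Integration by parts -/

theorem hasTemperateGrowth_schwingerDyson (V : Matrix (Fin N) (Fin N) ℂ) (m : ℕ) (i : List ℕ)
    (k l : Fin N) :
    HasTemperateGrowth fun y => schwingerDyson (φ y : Matrix (Fin N) (Fin N) ℂ) V m i k l :=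
  (((hasTemperateGrowth_powDeriv φ V m k l).mul (hasTemperateGrowth_multiTrace φ i)).add
    ((hasTemperateGrowth_pow φ m k l).mul (hasTemperateGrowth_multiTraceDeriv φ V i))).sub
    (((hasTemperateGrowth_pow φ m k l).mul (hasTemperateGrowth_multiTrace φ i)).mul
      (by simpa using hasTemperateGrowth_trace_pow_mul φ 1 V))

/-- The integrand is the derivative of `(X^m)_{kl} Tr(X^{i₁}) ⋯ e^{-Tr(X²)/2}` along `V`. As `V` is
Hermitian, it is a genuine direction in the domain of integration, so integration by parts along its
coordinate vector applies. -/
theorem integral_schwingerDyson_of_mem (V : Herm N) (m : ℕ) (i : List ℕ) (k l : Fin N) :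
    ∫ y, schwingerDyson (φ y : Matrix (Fin N) (Fin N) ℂ) V m i k l *
      gaussWeight (φ y : Matrix (Fin N) (Fin N) ℂ) = 0 := by
  obtain ⟨v, rfl⟩ := φ.surjective V
  have hline : ∀ y (t : ℝ), ((φ (y + t • v) : Herm N) : Matrix (Fin N) (Fin N) ℂ) =
      (φ y : Matrix (Fin N) (Fin N) ℂ) + t • (φ v : Matrix (Fin N) (Fin N) ℂ) := fun y t => by simp
  have hf := (hasTemperateGrowth_pow φ m k l).mul (hasTemperateGrowth_multiTrace φ i)
  have hf' := ((hasTemperateGrowth_powDeriv φ (φ v) m k l).mul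
    (hasTemperateGrowth_multiTrace φ i)).add
    ((hasTemperateGrowth_pow φ m k l).mul (hasTemperateGrowth_multiTraceDeriv φ (φ v) i))
  have ht : HasTemperateGrowth fun y => ((φ y : Matrix (Fin N) (Fin N) ℂ) * (φ v)).trace := by
    simpa using hasTemperateGrowth_trace_pow_mul φ 1 (φ v)
  have hfg' := integrable_mul_gaussWeight φ (hf.mul ht)
  have key := integral_bilinear_hasLineDerivAt_right_eq_neg_left_of_integrable
    (B := ContinuousLinearMap.mul ℝ ℂ) (v := v)
    (g := fun y => gaussWeight (φ y : Matrix (Fin N) (Fin N) ℂ))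
    (g' := fun y => -((φ y : Matrix (Fin N) (Fin N) ℂ) * (φ v)).trace *
      gaussWeight (φ y : Matrix (Fin N) (Fin N) ℂ))
    (integrable_mul_gaussWeight φ hf')
    (by simpa [mul_assoc] using hfg'.neg)
    (integrable_mul_gaussWeight φ hf)
    (fun y _ => by
      have := (hasDerivAt_pow_apply (φ y : Matrix (Fin N) (Fin N) ℂ) (φ v) m k l).fun_mul
        (hasDerivAt_multiTrace (φ y : Matrix (Fin N) (Fin N) ℂ) (φ v) i)
      simpa [HasLineDerivAt, hline] using this)
    (fun y _ => by
      have := hasDerivAt_gaussWeight (φ y : Matrix (Fin N) (Fin N) ℂ) (φ v)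
      simpa [HasLineDerivAt, hline] using this)
  simp only [ContinuousLinearMap.mul_apply'] at key
  rw [← sub_eq_zero, sub_neg_eq_add, add_comm, ← integral_add (integrable_mul_gaussWeight φ hf')
    (by simpa [mul_assoc] using hfg'.neg)] at key
  rw [← key]
  congr 1
  funext y
  simp only [schwingerDyson, Pi.add_apply, Pi.mul_apply]
  ring

theorem integral_schwingerDyson (V : Matrix (Fin N) (Fin N) ℂ) (m : ℕ) (i : List ℕ)
    (k l : Fin N) :
    ∫ y, schwingerDyson (φ y : Matrix (Fin N) (Fin N) ℂ) V m i k l *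
      gaussWeight (φ y : Matrix (Fin N) (Fin N) ℂ) = 0 := by
  -- Any matrix is `A + iB` with `A`, `B` Hermitian, and the integrand is complex-linear in the
  -- direction.
  have hV := realPart_add_I_smul_imaginaryPart V
  rw [← hV]
  simp only [schwingerDyson_add_smul, add_mul, mul_assoc]
  rw [integral_add, integral_const_mul, integral_schwingerDyson_of_mem,
    integral_schwingerDyson_of_mem, mul_zero, add_zero]
  · exact integrable_mul_gaussWeight φ (hasTemperateGrowth_schwingerDyson φ _ m i k l)
  · exact (integrable_mul_gaussWeight φ
      (hasTemperateGrowth_schwingerDyson φ _ m i k l)).const_mul _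

theorem integral_evalAt_differential_xi (m : ℕ) (i : List ℕ) :
    ∫ y, evalAt (φ y : Matrix (Fin N) (Fin N) ℂ)
        (differential (cls ((Letter.xi :: xWord m) :: xWords i))) *
      gaussWeight (φ y : Matrix (Fin N) (Fin N) ℂ) = 0 := by
  simp only [← sum_schwingerDyson, Finset.sum_mul]
  have h := fun k l => integrable_mul_gaussWeight φ
    (hasTemperateGrowth_schwingerDyson φ (Matrix.single k l 1) m i k l)
  rw [integral_finsetSum _ fun k _ => integrable_finsetSum _ fun l _ => h k l]
  refine Finset.sum_eq_zero fun k _ => ?_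
  rw [integral_finsetSum _ fun l _ => h k l]
  exact Finset.sum_eq_zero fun l _ => integral_schwingerDyson φ _ m i k l

theorem integrable_evalAt (z : SymCyc) :
    Integrable fun y => evalAt (φ y : Matrix (Fin N) (Fin N) ℂ) z *
      gaussWeight (φ y : Matrix (Fin N) (Fin N) ℂ) := by
  obtain ⟨z, rfl⟩ := relations.mkQ_surjective z
  induction z using Finsupp.induction_linear with
  | zero => simp
  | add z w hz hw =>
    simp only [map_add, add_mul]
    exact hz.add hw
  | single A c =>
    simp only [mkQ_single, map_smul, evalAt_cls, smul_eq_mul, mul_assoc, evalMulti]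
    refine Integrable.const_mul ?_ c
    split_ifs
    · exact integrable_mul_gaussWeight φ (hasTemperateGrowth_multiTrace φ _)
    · simp

/-- The Gaussian integral vanishes on coboundaries. -/
theorem integral_evalAt_differential (η : SymCyc) :
    ∫ y, evalAt (φ y : Matrix (Fin N) (Fin N) ℂ) (differential η) *
      gaussWeight (φ y : Matrix (Fin N) (Fin N) ℂ) = 0 := by
  obtain ⟨η, rfl⟩ := relations.mkQ_surjective η
  induction η using Finsupp.induction_linear with
  | zero => simp
  | add z w hz hw =>
    simp only [map_add, add_mul]
    rw [integral_add (integrable_evalAt φ _) (integrable_evalAt φ _), hz, hw, add_zero]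
  | single A c =>
    simp only [mkQ_single, map_smul, smul_eq_mul, mul_assoc]
    rw [integral_const_mul]
    -- Only products with exactly one `ξ` can contribute, and these reduce to the normal form `(ξ
    -- x^m) B` covered by the loop equation.
    by_cases h : mwt A = 1
    · obtain ⟨m, i, hA⟩ := exists_cls_eq_of_mwt_eq_one h
      rw [hA, integral_evalAt_differential_xi, mul_zero]
    · simp [evalAt_differential_of_mwt_ne_one _ h]

theorem eval_eq_of_cohomologous {i : List ℕ} {p : ℂ[X]}
    (h : Cohomologous (multiTraceCochain i) (ofNuPoly p)) :
    p.eval (N : ℂ) =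
      (∫ y, multiTrace i (φ y : Matrix (Fin N) (Fin N) ℂ) *
        gaussWeight (φ y : Matrix (Fin N) (Fin N) ℂ)) /
      (∫ y, gaussWeight (φ y : Matrix (Fin N) (Fin N) ℂ)) := by
  obtain ⟨η, hη⟩ := h
  have := integral_evalAt_differential φ η
  simp only [hη, map_sub, sub_mul] at this
  rw [integral_sub (integrable_evalAt φ _) (integrable_evalAt φ _), sub_eq_zero] at this
  simp only [evalAt_multiTraceCochain, evalAt_ofNuPoly] at this
  rw [this, integral_const_mul, mul_div_cancel_right₀ _ (integral_gaussWeight_ne_zero φ)]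

end Gaussian

/-! ### Existence and uniqueness of the polynomial -/

theorem exists_cohomologous (i : List ℕ) :
    ∃ p : ℂ[X], Cohomologous (multiTraceCochain i) (ofNuPoly p) := multiTraceCochain_mem i

/-- Both polynomials take the same matrix-integral value at every natural number `N`, and these
points are infinitely many. -/
theorem cohomologous_unique {i : List ℕ} {p q : ℂ[X]}
    (hp : Cohomologous (multiTraceCochain i) (ofNuPoly p))
    (hq : Cohomologous (multiTraceCochain i) (ofNuPoly q)) : p = q := by
  refine Polynomial.eq_of_infinite_eval_eq p q
    ((Set.infinite_range_of_injective (Nat.cast_injective (R := ℂ))).mono ?_)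
  rintro _ ⟨N, rfl⟩
  obtain ⟨n, ⟨φ⟩⟩ := exists_coordinates N
  exact (eval_eq_of_cohomologous φ hp).trans (eval_eq_of_cohomologous φ hq).symm

end NCBV

theorem mainTheorem6 (i : List ℕ) :
    NCBV.differential (NCBV.multiTraceCochain i) = 0 ∧
    (∃! p : ℂ[X], NCBV.Cohomologous (NCBV.multiTraceCochain i) (NCBV.ofNuPoly p)) ∧
    ∀ p : ℂ[X], NCBV.Cohomologous (NCBV.multiTraceCochain i) (NCBV.ofNuPoly p) →
      ∀ N : ℕ, 0 < N → ∀ (n : ℕ) (φ : (Fin n → ℝ) ≃ₗ[ℝ] NCBV.Herm N),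
        MeasureTheory.Integrable
          (fun y : Fin n → ℝ => NCBV.multiTrace i (φ y : Matrix (Fin N) (Fin N) ℂ) *
            NCBV.gaussWeight (φ y : Matrix (Fin N) (Fin N) ℂ)) MeasureTheory.volume ∧
        MeasureTheory.Integrable
          (fun y : Fin n → ℝ => NCBV.gaussWeight (φ y : Matrix (Fin N) (Fin N) ℂ))
          MeasureTheory.volume ∧
        (∫ y : Fin n → ℝ, NCBV.gaussWeight (φ y : Matrix (Fin N) (Fin N) ℂ)) ≠ 0 ∧
        p.eval (N : ℂ) =
          (∫ y : Fin n → ℝ, NCBV.multiTrace i (φ y : Matrix (Fin N) (Fin N) ℂ) *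
            NCBV.gaussWeight (φ y : Matrix (Fin N) (Fin N) ℂ)) /
          (∫ y : Fin n → ℝ, NCBV.gaussWeight (φ y : Matrix (Fin N) (Fin N) ℂ)) := by
  obtain ⟨p, hp⟩ := NCBV.exists_cohomologous i
  refine ⟨NCBV.differential_multiTraceCochain i,
    ⟨p, hp, fun q hq => NCBV.cohomologous_unique hq hp⟩, fun q hq N _ n φ => ⟨?_, ?_,
      NCBV.integral_gaussWeight_ne_zero φ, NCBV.eval_eq_of_cohomologous φ hq⟩⟩
  · exact NCBV.integrable_mul_gaussWeight φ (NCBV.hasTemperateGrowth_multiTrace φ i)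
  · simpa using NCBV.integrable_mul_gaussWeight φ (Function.HasTemperateGrowth.const 1)
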